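/- **Conventions.** A double category $\mathbb D$ is a pseudo double category: it has a category $\mathbb D_0$ of objects and arrows, a category $\mathbb D_1$ of proarrows $m\colon x\nrightarrow y$ and cells, and an external composition $m\odot n$ (written in diagrammatic order) with external identities $\mathrm{id}_x$, associative and unital up to coherent globular isomorphism. For a category $\mathsf S$ with pullbacks, $\mathbb{S}\mathrm{pan}(\mathsf S)$ is the double category with $\mathbb{S}\mathrm{pan}(\mathsf S)_0=\mathsf S$, with spans in $\mathsf S$ as proarrows, composed by pullback, and with maps of spans as cells. For a span of sets $I\xleftarrow{\ell}A\xrightarrow{r}J$ write $a\colon i\nrightarrow j$ when $a\in A$, $\ell(a)=i$ and $r(a)=j$. The contravariant double category of families $\mathbb F(\mathbb D)$ of a double category $\mathbb D$ has * as objects, families $(I,\vec x)$: a set $I$ and objects $x_i$ of $\mathbb D$ for $i\in I$; * as arrows $(I,\vec x)\to(J,\vec y)$, a function $f_0\colon J\to I$ with arrows $f_j\colon x_{f_0(j)}\to y_j$ for $j\in J$; * as proarrows $(I,\vec x)\nrightarrow(J,\vec y)$, an indexing span of sets $I\leftarrow A\to J$ with proarrows $m_a\colon x_i\nrightarrow y_j$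 for each $a\colon i\nrightarrow j$; * as cells from $(A,\vec m)\colon(I,\vec x)\nrightarrow(J,\vec y)$ to $(B,\vec n)\colon(K,\vec w)\nrightarrow(L,\vec z)$ with sides $(f_0,f)$ and $(g_0,g)$, a map of spans $\alpha_0\colon B\to A$ over $f_0\colon K\to I$ and $g_0\colon L\to J$ with cells $\alpha_b$ from $m_{\alpha_0(b)}$ to $n_b$ with sides $f_k$ and $g_l$, for each $b\colon k\nrightarrow l$. Proarrows of $\mathbb F(\mathbb D)$ are composed by taking the pullback $A\times_J B$ of the indexing spans and setting $(\vec m\odot\vec n)_{(a,b)}=m_a\odot n_b$; the identity on $(I,\vec x)$ is the family $\mathrm{id}_{\vec x}=(\mathrm{id}_{x_i})_{i\in I}$ indexed by $I=I=I$. Restricting all index sets and all apexes of indexing spans to be finite gives $\mathbb F_{\mathrm{fin}}(\mathbb D)$. The diagonal double functor $\Delta$ from $\mathbb D$ to $\mathbb F(\mathbb D)$ (or to $\mathbb F_{\mathrm{fin}}(\mathbb D)$) sends objects and proarrows to singleton families. **Definition.** A double category $\mathbb D$ has *iso-strong products* if $\Delta\colon\mathbb D\to\mathbb F(\mathbb D)$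 has a lax right adjoint $\Pi$, that is, a right adjoint in the 2-category of double categories, lax double functors and natural transformations, such that 1. for every composable pair of proarrow families $(A,\vec m)\colon(I,\vec x)\nrightarrow(J,\vec y)$ and $(B,\vec n)\colon(J,\vec y)\nrightarrow(K,\vec z)$ for which the legs $A\to J$ and $B\to J$ are bijections, the composition comparison cell $\Pi_{\vec m,\vec n}\colon\Pi\vec m\odot\Pi\vec n\to\Pi(\vec m\odot\vec n)$ is an isomorphism; 2. for every object family $(I,\vec x)$, the identity comparison cell $\Pi_{\vec x}\colon\mathrm{id}_{\Pi\vec x}\to\Pi(\mathrm{id}_{\vec x})$ is an isomorphism (the products are *normal*). It has *iso-strong finite products* if the same holds with $\mathbb F_{\mathrm{fin}}(\mathbb D)$ in place of $\mathbb F(\mathbb D)$. **Proposition.** If $\mathsf S$ is a complete category, then the double category $\mathbb{S}\mathrm{pan}(\mathsf S)$ has iso-strong products. If $\mathsf S$ is a finitely complete category, then $\mathbb{S}\mathrm{pan}(\mathsf S)$ has iso-strong finite products. -/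

import Mathlib

open CategoryTheory CategoryTheory.Limits

universe w u v p c u' v' p' c'

/-! ## Pseudo double categories

Cells are indexed by their whole boundary.  Two sides of a law whose boundaries agree only
propositionally (such as `f ≫ 𝟙 y` and `f`) are compared by heterogeneous equality `≍`. -/

/-- A pseudo double category with category of objects and arrows `X`.  External composition
`comp` of proarrows is written in diagrammatic order. -/
structure DoubleCategory (X : Type u) [Category.{v} X] where
  /-- Proarrows `x ⇸ y`. -/
  Pro : X → X → Type p
  /-- Cells with left side `f`, right side `g`, top `m` and bottom `n`. -/
  Cell : ∀ {x y x' y' : X}, (x ⟶ x') → (y ⟶ y') → Pro x y → Pro x' y' → Type c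
  /-- The identity of a proarrow in the category of proarrows and cells. -/
  vid : ∀ {x y : X} (m : Pro x y), Cell (𝟙 x) (𝟙 y) m m
  /-- Composition in the category of proarrows and cells. -/
  vcomp : ∀ {x y x' y' x'' y'' : X} {f : x ⟶ x'} {g : y ⟶ y'} {f' : x' ⟶ x''} {g' : y' ⟶ y''}
    {m : Pro x y} {n : Pro x' y'} {q : Pro x'' y''},
    Cell f g m n → Cell f' g' n q → Cell (f ≫ f') (g ≫ g') m q
  vid_vcomp : ∀ {x y x' y' : X} {f : x ⟶ x'} {g : y ⟶ y'} {m : Pro x y} {n : Pro x' y'}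
    (α : Cell f g m n), vcomp (vid m) α ≍ α
  vcomp_vid : ∀ {x y x' y' : X} {f : x ⟶ x'} {g : y ⟶ y'} {m : Pro x y} {n : Pro x' y'}
    (α : Cell f g m n), vcomp α (vid n) ≍ α
  vcomp_assoc : ∀ {x₀ y₀ x₁ y₁ x₂ y₂ x₃ y₃ : X} {f₁ : x₀ ⟶ x₁} {g₁ : y₀ ⟶ y₁} {f₂ : x₁ ⟶ x₂}
    {g₂ : y₁ ⟶ y₂} {f₃ : x₂ ⟶ x₃} {g₃ : y₂ ⟶ y₃} {m₀ : Pro x₀ y₀} {m₁ : Pro x₁ y₁}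
    {m₂ : Pro x₂ y₂} {m₃ : Pro x₃ y₃} (α : Cell f₁ g₁ m₀ m₁) (β : Cell f₂ g₂ m₁ m₂)
    (γ : Cell f₃ g₃ m₂ m₃), vcomp (vcomp α β) γ ≍ vcomp α (vcomp β γ)
  /-- The identity proarrow. -/
  idPro : ∀ x : X, Pro x x
  /-- The external identity cell on an arrow. -/
  idCell : ∀ {x x' : X} (f : x ⟶ x'), Cell f f (idPro x) (idPro x')
  idCell_id : ∀ x : X, idCell (𝟙 x) = vid (idPro x)
  idCell_comp : ∀ {x x' x'' : X} (f : x ⟶ x') (f' : x' ⟶ x''),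
    idCell (f ≫ f') = vcomp (idCell f) (idCell f')
  /-- External composition of proarrows. -/
  comp : ∀ {x y z : X}, Pro x y → Pro y z → Pro x z
  /-- External composition of cells. -/
  hcomp : ∀ {x y z x' y' z' : X} {f : x ⟶ x'} {g : y ⟶ y'} {h : z ⟶ z'} {m : Pro x y}
    {n : Pro y z} {m' : Pro x' y'} {n' : Pro y' z'},
    Cell f g m m' → Cell g h n n' → Cell f h (comp m n) (comp m' n')
  hcomp_vid : ∀ {x y z : X} (m : Pro x y) (n : Pro y z),
    hcomp (vid m) (vid n) = vid (comp m n)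
  hcomp_vcomp : ∀ {x y z x' y' z' x'' y'' z'' : X} {f : x ⟶ x'} {g : y ⟶ y'} {h : z ⟶ z'}
    {f' : x' ⟶ x''} {g' : y' ⟶ y''} {h' : z' ⟶ z''} {m : Pro x y} {n : Pro y z}
    {m' : Pro x' y'} {n' : Pro y' z'} {m'' : Pro x'' y''} {n'' : Pro y'' z''}
    (α : Cell f g m m') (β : Cell g h n n') (α' : Cell f' g' m' m'') (β' : Cell g' h' n' n''),
    hcomp (vcomp α α') (vcomp β β') = vcomp (hcomp α β) (hcomp α' β')
  /-- The associator, a natural globular isomorphism. -/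
  assoc : ∀ {x y z t : X} (m : Pro x y) (n : Pro y z) (q : Pro z t),
    Cell (𝟙 x) (𝟙 t) (comp (comp m n) q) (comp m (comp n q))
  assocInv : ∀ {x y z t : X} (m : Pro x y) (n : Pro y z) (q : Pro z t),
    Cell (𝟙 x) (𝟙 t) (comp m (comp n q)) (comp (comp m n) q)
  assoc_assocInv : ∀ {x y z t : X} (m : Pro x y) (n : Pro y z) (q : Pro z t),
    vcomp (assoc m n q) (assocInv m n q) ≍ vid (comp (comp m n) q)
  assocInv_assoc : ∀ {x y z t : X} (m : Pro x y) (n : Pro y z) (q : Pro z t),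
    vcomp (assocInv m n q) (assoc m n q) ≍ vid (comp m (comp n q))
  assoc_naturality : ∀ {x y z t x' y' z' t' : X} {f : x ⟶ x'} {g : y ⟶ y'} {h : z ⟶ z'}
    {k : t ⟶ t'} {m : Pro x y} {n : Pro y z} {q : Pro z t} {m' : Pro x' y'} {n' : Pro y' z'}
    {q' : Pro z' t'} (α : Cell f g m m') (β : Cell g h n n') (γ : Cell h k q q'),
    vcomp (hcomp (hcomp α β) γ) (assoc m' n' q') ≍ vcomp (assoc m n q) (hcomp α (hcomp β γ))
  /-- The left unitor, a natural globular isomorphism. -/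
  leftUnitor : ∀ {x y : X} (m : Pro x y), Cell (𝟙 x) (𝟙 y) (comp (idPro x) m) m
  leftUnitorInv : ∀ {x y : X} (m : Pro x y), Cell (𝟙 x) (𝟙 y) m (comp (idPro x) m)
  leftUnitor_leftUnitorInv : ∀ {x y : X} (m : Pro x y),
    vcomp (leftUnitor m) (leftUnitorInv m) ≍ vid (comp (idPro x) m)
  leftUnitorInv_leftUnitor : ∀ {x y : X} (m : Pro x y),
    vcomp (leftUnitorInv m) (leftUnitor m) ≍ vid m
  leftUnitor_naturality : ∀ {x y x' y' : X} {f : x ⟶ x'} {g : y ⟶ y'} {m : Pro x y}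
    {m' : Pro x' y'} (α : Cell f g m m'),
    vcomp (hcomp (idCell f) α) (leftUnitor m') ≍ vcomp (leftUnitor m) α
  /-- The right unitor, a natural globular isomorphism. -/
  rightUnitor : ∀ {x y : X} (m : Pro x y), Cell (𝟙 x) (𝟙 y) (comp m (idPro y)) m
  rightUnitorInv : ∀ {x y : X} (m : Pro x y), Cell (𝟙 x) (𝟙 y) m (comp m (idPro y))
  rightUnitor_rightUnitorInv : ∀ {x y : X} (m : Pro x y),
    vcomp (rightUnitor m) (rightUnitorInv m) ≍ vid (comp m (idPro y))
  rightUnitorInv_rightUnitor : ∀ {x y : X} (m : Pro x y),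
    vcomp (rightUnitorInv m) (rightUnitor m) ≍ vid m
  rightUnitor_naturality : ∀ {x y x' y' : X} {f : x ⟶ x'} {g : y ⟶ y'} {m : Pro x y}
    {m' : Pro x' y'} (α : Cell f g m m'),
    vcomp (hcomp α (idCell g)) (rightUnitor m') ≍ vcomp (rightUnitor m) α
  pentagon : ∀ {x y z t s : X} (m : Pro x y) (n : Pro y z) (q : Pro z t) (r : Pro t s),
    vcomp (vcomp (hcomp (assoc m n q) (vid r)) (assoc m (comp n q) r))
        (hcomp (vid m) (assoc n q r)) ≍
      vcomp (assoc (comp m n) q r) (assoc m n (comp q r))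
  triangle : ∀ {x y z : X} (m : Pro x y) (n : Pro y z),
    vcomp (assoc m (idPro y) n) (hcomp (vid m) (leftUnitor n)) ≍
      hcomp (rightUnitor m) (vid n)

namespace DoubleCategory

variable {X : Type u} [Category.{v} X]

/-- A globular cell is invertible, i.e. an isomorphism in the category of proarrows and cells. -/
def IsGlobularIso (D : DoubleCategory.{u, v, p, c} X) {x y : X} {m n : D.Pro x y}
    (α : D.Cell (𝟙 x) (𝟙 y) m n) : Prop :=
  ∃ β : D.Cell (𝟙 x) (𝟙 y) n m, D.vcomp α β ≍ D.vid m ∧ D.vcomp β α ≍ D.vid n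

end DoubleCategory

/-! ## Lax double functors and double adjunctions -/

/-- A lax double functor: a functor on objects and arrows, an assignment on proarrows and cells
that is functorial for vertical composition, and natural, coherent comparison cells
`F m ⊙ F n ⟶ F (m ⊙ n)` and `id (F x) ⟶ F (id x)`. -/
structure LaxDoubleFunctor {X : Type u} [Category.{v} X] {Y : Type u'} [Category.{v'} Y]
    (D : DoubleCategory.{u, v, p, c} X) (E : DoubleCategory.{u', v', p', c'} Y) where
  /-- The underlying functor on objects and arrows. -/
  base : X ⥤ Y
  pro : ∀ {x y : X}, D.Pro x y → E.Pro (base.obj x) (base.obj y)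
  cell : ∀ {x y x' y' : X} {f : x ⟶ x'} {g : y ⟶ y'} {m : D.Pro x y} {n : D.Pro x' y'},
    D.Cell f g m n → E.Cell (base.map f) (base.map g) (pro m) (pro n)
  cell_vid : ∀ {x y : X} (m : D.Pro x y), cell (D.vid m) ≍ E.vid (pro m)
  cell_vcomp : ∀ {x y x' y' x'' y'' : X} {f : x ⟶ x'} {g : y ⟶ y'} {f' : x' ⟶ x''}
    {g' : y' ⟶ y''} {m : D.Pro x y} {n : D.Pro x' y'} {q : D.Pro x'' y''}
    (α : D.Cell f g m n) (β : D.Cell f' g' n q),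
    cell (D.vcomp α β) ≍ E.vcomp (cell α) (cell β)
  /-- The composition comparison. -/
  laxator : ∀ {x y z : X} (m : D.Pro x y) (n : D.Pro y z),
    E.Cell (𝟙 (base.obj x)) (𝟙 (base.obj z)) (E.comp (pro m) (pro n)) (pro (D.comp m n))
  /-- The identity comparison. -/
  unitor : ∀ x : X,
    E.Cell (𝟙 (base.obj x)) (𝟙 (base.obj x)) (E.idPro (base.obj x)) (pro (D.idPro x))
  laxator_naturality : ∀ {x y z x' y' z' : X} {f : x ⟶ x'} {g : y ⟶ y'} {h : z ⟶ z'}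
    {m : D.Pro x y} {n : D.Pro y z} {m' : D.Pro x' y'} {n' : D.Pro y' z'}
    (α : D.Cell f g m m') (β : D.Cell g h n n'),
    E.vcomp (E.hcomp (cell α) (cell β)) (laxator m' n') ≍
      E.vcomp (laxator m n) (cell (D.hcomp α β))
  unitor_naturality : ∀ {x x' : X} (f : x ⟶ x'),
    E.vcomp (E.idCell (base.map f)) (unitor x') ≍ E.vcomp (unitor x) (cell (D.idCell f))
  laxator_assoc : ∀ {x y z t : X} (m : D.Pro x y) (n : D.Pro y z) (q : D.Pro z t),
    E.vcomp (E.vcomp (E.hcomp (laxator m n) (E.vid (pro q))) (laxator (D.comp m n) q))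
        (cell (D.assoc m n q)) ≍
      E.vcomp (E.assoc (pro m) (pro n) (pro q))
        (E.vcomp (E.hcomp (E.vid (pro m)) (laxator n q)) (laxator m (D.comp n q)))
  laxator_leftUnit : ∀ {x y : X} (m : D.Pro x y),
    E.vcomp (E.vcomp (E.hcomp (unitor x) (E.vid (pro m))) (laxator (D.idPro x) m))
        (cell (D.leftUnitor m)) ≍ E.leftUnitor (pro m)
  laxator_rightUnit : ∀ {x y : X} (m : D.Pro x y),
    E.vcomp (E.vcomp (E.hcomp (E.vid (pro m)) (unitor y)) (laxator m (D.idPro y)))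
        (cell (D.rightUnitor m)) ≍ E.rightUnitor (pro m)

/-- An adjunction `L ⊣ R` in the 2-category of double categories, lax double functors and natural
transformations: the unit `1 ⟹ R ∘ L` and the counit `L ∘ R ⟹ 1` have components at objects (an
ordinary adjunction) and at proarrows; they are natural in cells, compatible with the composition
and identity comparisons of the composite lax functors, and satisfy the triangle identities. -/
structure DoubleAdjunction {X : Type u} [Category.{v} X] {Y : Type u'} [Category.{v'} Y]
    {D : DoubleCategory.{u, v, p, c} X} {E : DoubleCategory.{u', v', p', c'} Y}
    (L : LaxDoubleFunctor D E) (R : LaxDoubleFunctor E D) where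
  /-- The adjunction between the categories of objects and arrows. -/
  adj : L.base ⊣ R.base
  unit : ∀ {x y : X} (m : D.Pro x y),
    D.Cell (x' := R.base.obj (L.base.obj x)) (y' := R.base.obj (L.base.obj y))
      (adj.unit.app x) (adj.unit.app y) m (R.pro (L.pro m))
  counit : ∀ {x y : Y} (m : E.Pro x y),
    E.Cell (x := L.base.obj (R.base.obj x)) (y := L.base.obj (R.base.obj y))
      (adj.counit.app x) (adj.counit.app y) (L.pro (R.pro m)) m
  unit_naturality : ∀ {x y x' y' : X} {f : x ⟶ x'} {g : y ⟶ y'} {m : D.Pro x y}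
    {n : D.Pro x' y'} (α : D.Cell f g m n),
    D.vcomp α (unit n) ≍ D.vcomp (unit m) (R.cell (L.cell α))
  counit_naturality : ∀ {x y x' y' : Y} {f : x ⟶ x'} {g : y ⟶ y'} {m : E.Pro x y}
    {n : E.Pro x' y'} (α : E.Cell f g m n),
    E.vcomp (L.cell (R.cell α)) (counit n) ≍ E.vcomp (counit m) α
  unit_comp : ∀ {x y z : X} (m : D.Pro x y) (n : D.Pro y z),
    unit (D.comp m n) ≍ D.vcomp (D.hcomp (unit m) (unit n))
      (D.vcomp (R.laxator (L.pro m) (L.pro n)) (R.cell (L.laxator m n)))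
  unit_id : ∀ x : X,
    unit (D.idPro x) ≍ D.vcomp (D.idCell (adj.unit.app x))
      (D.vcomp (R.unitor (L.base.obj x)) (R.cell (L.unitor x)))
  counit_comp : ∀ {x y z : Y} (m : E.Pro x y) (n : E.Pro y z),
    E.vcomp (E.vcomp (L.laxator (R.pro m) (R.pro n)) (L.cell (R.laxator m n)))
      (counit (E.comp m n)) ≍ E.hcomp (counit m) (counit n)
  counit_id : ∀ x : Y,
    E.vcomp (E.vcomp (L.unitor (R.base.obj x)) (L.cell (R.unitor x)))
      (counit (E.idPro x)) ≍ E.idCell (adj.counit.app x)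
  left_triangle : ∀ {x y : X} (m : D.Pro x y),
    E.vcomp (L.cell (unit m)) (counit (L.pro m)) ≍ E.vid (L.pro m)
  right_triangle : ∀ {x y : Y} (m : E.Pro x y),
    D.vcomp (unit (R.pro m)) (R.cell (counit m)) ≍ D.vid (R.pro m)

/-! ## The contravariant double category of families -/

/-- Whether families are indexed by arbitrary small sets or by finite sets. -/
inductive FamilySize where
  | small
  | finite

/-- The index sets allowed for a given size. -/
def FamilySize.Admits : FamilySize → Type w → Prop
  | small, _ => True
  | finite, I => Finite I

theorem FamilySize.admits_punit : ∀ κ : FamilySize, κ.Admits PUnit.{w + 1}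
  | small => trivial
  | finite => inferInstanceAs (Finite PUnit)

/-- A span of (admissible) sets `I ⟵ A ⟶ J`. -/
structure IndexSpan (κ : FamilySize) (I J : Type w) where
  apex : Type w
  admits : κ.Admits apex
  l : apex → I
  r : apex → J

namespace IndexSpan

variable {κ : FamilySize} {I J K L : Type w}

/-- The elements `a : i ⇸ j` of a span: those `a` in the apex that lie over `i` and `j`. -/
def Elt (A : IndexSpan κ I J) (i : I) (j : J) : Type w :=
  {a : A.apex // A.l a = i ∧ A.r a = j}

/-- The identity span. -/
def id (I : Type w) (h : κ.Admits I) : IndexSpan κ I I := ⟨I, h, fun i => i, fun i => i⟩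

theorem admits_pullback {A B : Type w} (hA : κ.Admits A) (hJ : κ.Admits J) (hB : κ.Admits B)
    (q : A × J × B → Prop) : κ.Admits {t : A × J × B // q t} := by
  cases κ with
  | small => trivial
  | finite =>
    have : Finite A := hA
    have : Finite J := hJ
    have : Finite B := hB
    exact inferInstanceAs (Finite {t : A × J × B // q t})

/-- Composition of spans of sets by pullback.  The pullback of `A ⟶ J ⟵ B` is presented as the
limit of the cospan: the set of triples `(a, j, b)` with `r a = j = l b`. -/
def comp (hJ : κ.Admits J) (A : IndexSpan κ I J) (B : IndexSpan κ J K) : IndexSpan κ I K where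
  apex := {t : A.apex × J × B.apex // A.r t.1 = t.2.1 ∧ B.l t.2.2 = t.2.1}
  admits := admits_pullback A.admits hJ B.admits _
  l t := A.l t.1.1
  r t := B.r t.1.2.2

/-- The component in the first factor of an element of a composite span. -/
def Elt.fst {hJ : κ.Admits J} {A : IndexSpan κ I J} {B : IndexSpan κ J K} {i : I} {k : K}
    (e : (comp hJ A B).Elt i k) : A.Elt i e.1.1.2.1 :=
  ⟨e.1.1.1, e.2.1, e.1.2.1⟩

/-- The component in the second factor of an element of a composite span. -/
def Elt.snd {hJ : κ.Admits J} {A : IndexSpan κ I J} {B : IndexSpan κ J K} {i : I} {k : K}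
    (e : (comp hJ A B).Elt i k) : B.Elt e.1.1.2.1 k :=
  ⟨e.1.1.2.2, e.1.2.2, e.2.2⟩

/-- Maps of spans over functions `φ` and `ψ` between the feet. -/
structure Map (φ : K → I) (ψ : L → J) (B : IndexSpan κ K L) (A : IndexSpan κ I J) where
  apex : B.apex → A.apex
  l_apex : ∀ b, A.l (apex b) = φ (B.l b)
  r_apex : ∀ b, A.r (apex b) = ψ (B.r b)

/-- The action of a map of spans on elements `b : k ⇸ l`. -/
def Map.elt {φ : K → I} {ψ : L → J} {B : IndexSpan κ K L} {A : IndexSpan κ I J}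
    (α : Map φ ψ B A) {k : K} {l : L} (b : B.Elt k l) : A.Elt (φ k) (ψ l) :=
  ⟨α.apex b.1, (α.l_apex b.1).trans (congrArg φ b.2.1), (α.r_apex b.1).trans (congrArg ψ b.2.2)⟩

end IndexSpan

/-- An indexed family of objects. -/
structure FamOp (κ : FamilySize) (X : Type u) where
  I : Type w
  admits : κ.Admits I
  obj : I → X

namespace FamOp

variable {κ : FamilySize} {X : Type u} [Category.{v} X]

/-- An arrow of contravariant families: a function `J → I` between index sets and arrows
`x (f₀ j) ⟶ y j`. -/
@[ext]
structure Hom (x y : FamOp.{w} κ X) where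
  idx : y.I → x.I
  hom : ∀ j, x.obj (idx j) ⟶ y.obj j

instance : Category (FamOp.{w} κ X) where
  Hom := Hom
  id x := ⟨fun i => i, fun i => 𝟙 (x.obj i)⟩
  comp f g := ⟨fun k => f.idx (g.idx k), fun k => f.hom (g.idx k) ≫ g.hom k⟩

variable (D : DoubleCategory.{u, v, p, c} X)

/-- A proarrow between families: an indexing span `A` and proarrows `m a : x i ⇸ y j` for each
`a : i ⇸ j`. -/
structure Pro (x y : FamOp.{w} κ X) where
  span : IndexSpan κ x.I y.I
  pro : ∀ {i : x.I} {j : y.I}, span.Elt i j → D.Pro (x.obj i) (y.obj j)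

variable {D}

/-- A cell between families of proarrows: a map of spans `B ⟶ A` and, for each `b : k ⇸ l` in `B`,
a cell from `m (α₀ b)` to `n b`. -/
structure Cell {x y x' y' : FamOp.{w} κ X} (f : x ⟶ x') (g : y ⟶ y') (m : Pro D x y)
    (n : Pro D x' y') where
  map : IndexSpan.Map f.idx g.idx n.span m.span
  cell : ∀ {k : x'.I} {l : y'.I} (b : n.span.Elt k l),
    D.Cell (f.hom k) (g.hom l) (m.pro (map.elt b)) (n.pro b)

theorem Cell.hext {x y x' y' : FamOp.{w} κ X} {f f' : x ⟶ x'} {g g' : y ⟶ y'} {m : Pro D x y}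
    {n : Pro D x' y'} {α : Cell f g m n} {β : Cell f' g' m n} (hf : f = f') (hg : g = g')
    (h₀ : ∀ b, α.map.apex b = β.map.apex b)
    (h : ∀ {k : x'.I} {l : y'.I} (b : n.span.Elt k l), α.cell b ≍ β.cell b) : α ≍ β := by
  subst hf hg
  obtain ⟨⟨a, _, _⟩, α⟩ := α
  obtain ⟨⟨b, _, _⟩, β⟩ := β
  obtain rfl : a = b := funext h₀
  have : @α = @β := by
    funext k l b
    exact eq_of_heq (h b)
  subst this
  rfl

variable (D)

/-- The identity proarrows `x i ⇸ x i'` of a family, for `i = i'`. -/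
def idFamily (x : FamOp.{w} κ X) {i i' : x.I} (e : (IndexSpan.id x.I x.admits).Elt i i') :
    D.Pro (x.obj i) (x.obj i') :=
  (e.2.1.symm.trans e.2.2) ▸ D.idPro (x.obj i)

/-- The external identity cell on a family of arrows. -/
def idCell {x x' : FamOp.{w} κ X} (f : x ⟶ x') :
    Cell f f (⟨IndexSpan.id x.I x.admits, idFamily D x⟩ : Pro D x x)
      (⟨IndexSpan.id x'.I x'.admits, idFamily D x'⟩ : Pro D x' x') where
  map := ⟨f.idx, fun _ => rfl, fun _ => rfl⟩
  cell :=
    have aux : ∀ {k k' : x'.I} (a : x'.I) (h : a = k) (h' : a = k'),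
        D.Cell (f.hom k) (f.hom k')
          (idFamily D x ⟨f.idx a, congrArg f.idx h, congrArg f.idx h'⟩)
          (idFamily D x' ⟨a, h, h'⟩) := by
      rintro k _ a rfl rfl
      exact D.idCell (f.hom a)
    fun e => aux e.1 e.2.1 e.2.2

/-- External composition of families of proarrows: compose the indexing spans by pullback and the
proarrows componentwise. -/
def comp {x y z : FamOp.{w} κ X} (m : Pro D x y) (n : Pro D y z) : Pro D x z where
  span := IndexSpan.comp y.admits m.span n.span
  pro e := D.comp (m.pro e.fst) (n.pro e.snd)

/-- The left unitor, given componentwise by the left unitors of `D`. -/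
def leftUnitor {x y : FamOp.{w} κ X} (m : Pro D x y) :
    Cell (𝟙 x) (𝟙 y) (comp D ⟨IndexSpan.id x.I x.admits, idFamily D x⟩ m) m where
  map := ⟨fun a => ⟨(m.span.l a, m.span.l a, a), rfl, rfl⟩, fun _ => rfl, fun _ => rfl⟩
  cell :=
    have aux : ∀ {i : x.I} {j : y.I} (a : m.span.apex) (h : m.span.l a = i)
        (h' : m.span.r a = j), D.Cell (𝟙 (x.obj i)) (𝟙 (y.obj j))
          (D.comp (idFamily D x ⟨m.span.l a, h, rfl⟩) (m.pro ⟨a, rfl, h'⟩))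
          (m.pro ⟨a, h, h'⟩) := by
      rintro _ _ a rfl rfl
      exact D.leftUnitor (m.pro ⟨a, rfl, rfl⟩)
    fun e => aux e.1 e.2.1 e.2.2

/-- The right unitor, given componentwise by the right unitors of `D`. -/
def rightUnitor {x y : FamOp.{w} κ X} (m : Pro D x y) :
    Cell (𝟙 x) (𝟙 y) (comp D m ⟨IndexSpan.id y.I y.admits, idFamily D y⟩) m where
  map := ⟨fun a => ⟨(a, m.span.r a, m.span.r a), rfl, rfl⟩, fun _ => rfl, fun _ => rfl⟩
  cell :=
    have aux : ∀ {i : x.I} {j : y.I} (a : m.span.apex) (h : m.span.l a = i)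
        (h' : m.span.r a = j), D.Cell (𝟙 (x.obj i)) (𝟙 (y.obj j))
          (D.comp (m.pro ⟨a, h, rfl⟩) (idFamily D y ⟨m.span.r a, rfl, h'⟩))
          (m.pro ⟨a, h, h'⟩) := by
      rintro _ _ a rfl rfl
      exact D.rightUnitor (m.pro ⟨a, rfl, rfl⟩)
    fun e => aux e.1 e.2.1 e.2.2

theorem leftUnitor_vcomp {x y : FamOp.{w} κ X} (m : Pro D x y) {i : x.I} {j : y.I}
    (e : m.span.Elt i j) {s t : X} {f : x.obj i ⟶ s} {g : y.obj j ⟶ t} {q : D.Pro s t}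
    (β : D.Cell f g (m.pro e) q) :
    D.vcomp ((leftUnitor D m).cell e) β ≍ D.vcomp (D.leftUnitor (m.pro e)) β := by
  obtain ⟨a, rfl, rfl⟩ := e
  rfl

theorem rightUnitor_vcomp {x y : FamOp.{w} κ X} (m : Pro D x y) {i : x.I} {j : y.I}
    (e : m.span.Elt i j) {s t : X} {f : x.obj i ⟶ s} {g : y.obj j ⟶ t} {q : D.Pro s t}
    (β : D.Cell f g (m.pro e) q) :
    D.vcomp ((rightUnitor D m).cell e) β ≍ D.vcomp (D.rightUnitor (m.pro e)) β := by
  obtain ⟨a, rfl, rfl⟩ := e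
  rfl

theorem rightUnitor_hcomp {x y : FamOp.{w} κ X} (m : Pro D x y) {i : x.I} {j : y.I}
    (e : m.span.Elt i j) {t t' : X} {g : t ⟶ t'} {n : D.Pro (y.obj j) t}
    {n' : D.Pro (y.obj j) t'} (β : D.Cell (𝟙 (y.obj j)) g n n') :
    D.hcomp ((rightUnitor D m).cell e) β ≍ D.hcomp (D.rightUnitor (m.pro e)) β := by
  obtain ⟨a, rfl, rfl⟩ := e
  rfl

/-- The double category of contravariant families in a double category, indexed by sets of the
given size. -/
def doubleCategory (κ : FamilySize) (D : DoubleCategory.{u, v, p, c} X) :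
    DoubleCategory.{max (w + 1) u, max w v, max (w + 1) p, max w c} (FamOp.{w} κ X) where
  Pro := Pro D
  Cell := Cell
  vid m := ⟨⟨fun a => a, fun _ => rfl, fun _ => rfl⟩, fun a => D.vid (m.pro a)⟩
  vcomp α β :=
    { map := ⟨fun b => α.map.apex (β.map.apex b),
        fun b => (α.map.l_apex _).trans (congrArg _ (β.map.l_apex b)),
        fun b => (α.map.r_apex _).trans (congrArg _ (β.map.r_apex b))⟩
      cell := fun b => D.vcomp (α.cell (β.map.elt b)) (β.cell b) }
  vid_vcomp α := Cell.hext (Category.id_comp _) (Category.id_comp _) (fun _ => rfl)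
    (fun _ => D.vid_vcomp _)
  vcomp_vid α := Cell.hext (Category.comp_id _) (Category.comp_id _) (fun _ => rfl)
    (fun _ => D.vcomp_vid _)
  vcomp_assoc α β γ := Cell.hext (Category.assoc _ _ _) (Category.assoc _ _ _) (fun _ => rfl)
    (fun _ => D.vcomp_assoc _ _ _)
  idPro x := ⟨IndexSpan.id x.I x.admits, idFamily D x⟩
  idCell f := idCell D f
  idCell_id x := eq_of_heq <| Cell.hext rfl rfl (fun _ => rfl) (by
    rintro k _ ⟨a, rfl, rfl⟩
    exact heq_of_eq (D.idCell_id _))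
  idCell_comp f g := eq_of_heq <| Cell.hext rfl rfl (fun _ => rfl) (by
    rintro k _ ⟨a, rfl, rfl⟩
    exact heq_of_eq (D.idCell_comp (f.hom (g.idx _)) (g.hom _)))
  comp m n := comp D m n
  hcomp {_ _ _ _ _ _ _ g _ _ _ _ _} α β :=
    { map := ⟨fun t => ⟨(α.map.apex t.1.1, g.idx t.1.2.1, β.map.apex t.1.2.2),
          (α.map.r_apex _).trans (congrArg g.idx t.2.1),
          (β.map.l_apex _).trans (congrArg g.idx t.2.2)⟩,
        fun t => α.map.l_apex _, fun t => β.map.r_apex _⟩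
      cell := fun e => D.hcomp (α.cell e.fst) (β.cell e.snd) }
  hcomp_vid m n := eq_of_heq <| Cell.hext rfl rfl (fun _ => rfl)
    (fun _ => heq_of_eq (D.hcomp_vid _ _))
  hcomp_vcomp α β α' β' := eq_of_heq <| Cell.hext rfl rfl (fun _ => rfl)
    (fun _ => heq_of_eq (D.hcomp_vcomp _ _ _ _))
  assoc m n q :=
    { map := ⟨fun t => ⟨(⟨(t.1.1, t.1.2.1, t.1.2.2.1.1), t.2.1, t.2.2⟩, t.1.2.2.1.2.1,
          t.1.2.2.1.2.2), t.1.2.2.2.1, t.1.2.2.2.2⟩, fun _ => rfl, fun _ => rfl⟩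
      cell := fun e => D.assoc (m.pro e.fst) (n.pro e.snd.fst) (q.pro e.snd.snd) }
  assocInv m n q :=
    { map := ⟨fun t => ⟨(t.1.1.1.1, t.1.1.1.2.1, ⟨(t.1.1.1.2.2, t.1.2.1, t.1.2.2),
          t.2.1, t.2.2⟩), t.1.1.2.1, t.1.1.2.2⟩, fun _ => rfl, fun _ => rfl⟩
      cell := fun e => D.assocInv (m.pro e.fst.fst) (n.pro e.fst.snd) (q.pro e.snd) }
  assoc_assocInv m n q := Cell.hext (Category.id_comp _) (Category.id_comp _) (fun _ => rfl)
    (fun _ => D.assoc_assocInv _ _ _)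
  assocInv_assoc m n q := Cell.hext (Category.id_comp _) (Category.id_comp _) (fun _ => rfl)
    (fun _ => D.assocInv_assoc _ _ _)
  assoc_naturality α β γ := Cell.hext
    ((Category.comp_id _).trans (Category.id_comp _).symm)
    ((Category.comp_id _).trans (Category.id_comp _).symm) (fun _ => rfl)
    (fun _ => D.assoc_naturality _ _ _)
  leftUnitor m := leftUnitor D m
  leftUnitorInv {x y} m :=
    { map := ⟨fun t => t.1.2.2, fun t => t.2.2.trans t.2.1.symm, fun _ => rfl⟩
      cell :=
        have aux : ∀ {i : x.I} {j : y.I} (i' i'' : x.I) (a : m.span.apex) (h : i' = i'')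
            (h₁ : m.span.l a = i'') (h₂ : i' = i) (h₃ : m.span.r a = j),
            D.Cell (𝟙 (x.obj i)) (𝟙 (y.obj j)) (m.pro ⟨a, h₁.trans (h.symm.trans h₂), h₃⟩)
              (D.comp (idFamily D x ⟨i', h₂, h⟩) (m.pro ⟨a, h₁, h₃⟩)) := by
          rintro _ j i' _ a rfl h₁ rfl h₃
          exact D.leftUnitorInv (m.pro ⟨a, h₁, h₃⟩)
        fun e => aux e.1.1.1 e.1.1.2.1 e.1.1.2.2 e.1.2.1 e.1.2.2 e.2.1 e.2.2 }
  leftUnitor_leftUnitorInv m := Cell.hext (Category.id_comp _) (Category.id_comp _)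
    (by
      rintro ⟨⟨i', i'', a⟩, h, h'⟩
      obtain rfl : i' = i'' := h
      obtain rfl : m.span.l a = i' := h'
      rfl)
    (by
      rintro i j ⟨⟨⟨i', i'', a⟩, h, h'⟩, h'', h'''⟩
      obtain rfl : i' = i := h''
      obtain rfl : i' = i'' := h
      obtain rfl : m.span.l a = i' := h'
      obtain rfl : m.span.r a = j := h'''
      exact D.leftUnitor_leftUnitorInv (m.pro ⟨a, rfl, rfl⟩))
  leftUnitorInv_leftUnitor m := Cell.hext (Category.id_comp _) (Category.id_comp _)
    (fun _ => rfl)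
    (by
      rintro _ _ ⟨a, rfl, rfl⟩
      exact D.leftUnitorInv_leftUnitor (m.pro ⟨a, rfl, rfl⟩))
  leftUnitor_naturality {_ _ _ _ _ _ m _} α := Cell.hext
    ((Category.comp_id _).trans (Category.id_comp _).symm)
    ((Category.comp_id _).trans (Category.id_comp _).symm)
    (fun b => by
      have h := α.map.l_apex b
      exact Subtype.ext (Prod.ext h.symm (Prod.ext h.symm rfl)))
    (by
      rintro _ _ ⟨b, rfl, rfl⟩
      exact (D.leftUnitor_naturality (α.cell ⟨b, rfl, rfl⟩)).trans
        (leftUnitor_vcomp D m _ (α.cell ⟨b, rfl, rfl⟩)).symm)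
  rightUnitor m := rightUnitor D m
  rightUnitorInv {x y} m :=
    { map := ⟨fun t => t.1.1, fun t => rfl, fun t => t.2.1.trans t.2.2.symm⟩
      cell :=
        have aux : ∀ {i : x.I} {j : y.I} (a : m.span.apex) (j'' j' : y.I)
            (h₁ : m.span.r a = j'') (h : j' = j'') (h₃ : m.span.l a = i) (h₂ : j' = j),
            D.Cell (𝟙 (x.obj i)) (𝟙 (y.obj j)) (m.pro ⟨a, h₃, h₁.trans (h.symm.trans h₂)⟩)
              (D.comp (m.pro ⟨a, h₃, h₁⟩) (idFamily D y ⟨j', h, h₂⟩)) := by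
          rintro i _ a _ j' h₁ rfl h₃ rfl
          exact D.rightUnitorInv (m.pro ⟨a, h₃, h₁⟩)
        fun e => aux e.1.1.1 e.1.1.2.1 e.1.1.2.2 e.1.2.1 e.1.2.2 e.2.1 e.2.2 }
  rightUnitor_rightUnitorInv m := Cell.hext (Category.id_comp _) (Category.id_comp _)
    (by
      rintro ⟨⟨a, j'', j'⟩, h', h⟩
      obtain rfl : j' = j'' := h
      obtain rfl : m.span.r a = j' := h'
      rfl)
    (by
      rintro i j ⟨⟨⟨a, j'', j'⟩, h', h⟩, h'', h'''⟩
      obtain rfl : j' = j := h'''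
      obtain rfl : j' = j'' := h
      obtain rfl : m.span.r a = j' := h'
      obtain rfl : m.span.l a = i := h''
      exact D.rightUnitor_rightUnitorInv (m.pro ⟨a, rfl, rfl⟩))
  rightUnitorInv_rightUnitor m := Cell.hext (Category.id_comp _) (Category.id_comp _)
    (fun _ => rfl)
    (by
      rintro _ _ ⟨a, rfl, rfl⟩
      exact D.rightUnitorInv_rightUnitor (m.pro ⟨a, rfl, rfl⟩))
  rightUnitor_naturality {_ _ _ _ _ _ m _} α := Cell.hext
    ((Category.comp_id _).trans (Category.id_comp _).symm)
    ((Category.comp_id _).trans (Category.id_comp _).symm)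
    (fun b => by
      have h := α.map.r_apex b
      exact Subtype.ext (Prod.ext rfl (Prod.ext h.symm h.symm)))
    (by
      rintro _ _ ⟨b, rfl, rfl⟩
      exact (D.rightUnitor_naturality (α.cell ⟨b, rfl, rfl⟩)).trans
        (rightUnitor_vcomp D m _ (α.cell ⟨b, rfl, rfl⟩)).symm)
  pentagon m n q r := Cell.hext
    ((Category.assoc _ _ _).trans (Category.id_comp _))
    ((Category.assoc _ _ _).trans (Category.id_comp _)) (fun _ => rfl)
    (fun _ => D.pentagon _ _ _ _)
  triangle m n := Cell.hext (Category.id_comp _) (Category.id_comp _)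
    (by
      rintro ⟨⟨a, j, b⟩, h, h'⟩
      obtain rfl : m.span.r a = j := h
      exact Subtype.ext (Prod.ext (Subtype.ext (Prod.ext rfl (Prod.ext rfl h')))
        (Prod.ext h' rfl)))
    (by
      rintro i k ⟨⟨⟨a, j, b⟩, h, h'⟩, h'', h'''⟩
      obtain rfl : n.span.l b = j := h'
      obtain rfl : n.span.r b = k := h'''
      exact (D.triangle (m.pro ⟨a, h'', h⟩) (n.pro ⟨b, rfl, rfl⟩)).trans
        (rightUnitor_hcomp D m ⟨a, h'', h⟩ (D.vid (n.pro ⟨b, rfl, rfl⟩))).symm)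

end FamOp

/-! ## The diagonal double functor and products -/

section Products

variable {X : Type u} [Category.{v} X]

/-- The functor from a category to its contravariant families that sends objects to singleton
families. -/
def diagonalBase (κ : FamilySize) (X : Type u) [Category.{v} X] : X ⥤ FamOp.{w} κ X where
  obj x := ⟨PUnit, κ.admits_punit, fun _ => x⟩
  map f := ⟨fun i => i, fun _ => f⟩

/-- The double functor from a double category to its contravariant families that sends objects and
proarrows to singleton families. -/
def diagonal (κ : FamilySize) (D : DoubleCategory.{u, v, p, c} X) :
    LaxDoubleFunctor D (FamOp.doubleCategory.{w} κ D) where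
  base := diagonalBase.{w} κ X
  pro m := ⟨⟨PUnit, κ.admits_punit, fun i => i, fun i => i⟩, fun _ => m⟩
  cell α := ⟨⟨fun i => i, fun _ => rfl, fun _ => rfl⟩, fun _ => α⟩
  cell_vid m := HEq.rfl
  cell_vcomp α β := HEq.rfl
  laxator m n := ⟨⟨fun i => ⟨(i, i, i), rfl, rfl⟩, fun _ => rfl, fun _ => rfl⟩,
    fun _ => D.vid (D.comp m n)⟩
  unitor x := ⟨⟨fun i => i, fun _ => rfl, fun _ => rfl⟩, by
    rintro ⟨⟩ ⟨⟩ _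
    exact D.vid (D.idPro x)⟩
  laxator_naturality α β := FamOp.Cell.hext
    ((Category.comp_id _).trans (Category.id_comp _).symm)
    ((Category.comp_id _).trans (Category.id_comp _).symm) (fun _ => rfl)
    (fun _ => (D.vcomp_vid _).trans (D.vid_vcomp _).symm)
  unitor_naturality f := FamOp.Cell.hext
    ((Category.comp_id _).trans (Category.id_comp _).symm)
    ((Category.comp_id _).trans (Category.id_comp _).symm) (fun _ => rfl)
    (by
      rintro ⟨⟩ ⟨⟩ _
      exact (D.vcomp_vid (D.idCell f)).trans (D.vid_vcomp (D.idCell f)).symm)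
  laxator_assoc m n q := FamOp.Cell.hext
    (by erw [CategoryTheory.Functor.map_id]; simp) (by erw [CategoryTheory.Functor.map_id]; simp)
    (fun _ => rfl)
    (fun _ => by
      change D.vcomp (D.vcomp (D.hcomp (D.vid (D.comp m n)) (D.vid q))
          (D.vid (D.comp (D.comp m n) q))) (D.assoc m n q) ≍
        D.vcomp (D.assoc m n q) (D.vcomp (D.hcomp (D.vid m) (D.vid (D.comp n q)))
          (D.vid (D.comp m (D.comp n q))))
      rw [D.hcomp_vid, D.hcomp_vid]
      exact ((D.vcomp_assoc _ _ _).trans ((D.vid_vcomp _).trans (D.vid_vcomp _))).trans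
        ((D.vcomp_assoc _ _ _).symm.trans ((D.vcomp_vid _).trans (D.vcomp_vid _))).symm)
  laxator_leftUnit {_ _} m := FamOp.Cell.hext
    (by erw [CategoryTheory.Functor.map_id]; simp) (by erw [CategoryTheory.Functor.map_id]; simp) (fun _ => rfl)
    (by
      rintro ⟨⟩ ⟨⟩ _
      change D.vcomp (D.vcomp (D.hcomp (D.vid (D.idPro _)) (D.vid m))
          (D.vid (D.comp (D.idPro _) m))) (D.leftUnitor m) ≍ D.leftUnitor m
      rw [D.hcomp_vid]
      exact (D.vcomp_assoc _ _ _).trans ((D.vid_vcomp _).trans (D.vid_vcomp _)))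
  laxator_rightUnit {_ _} m := FamOp.Cell.hext
    (by erw [CategoryTheory.Functor.map_id]; simp) (by erw [CategoryTheory.Functor.map_id]; simp) (fun _ => rfl)
    (by
      rintro ⟨⟩ ⟨⟩ _
      change D.vcomp (D.vcomp (D.hcomp (D.vid m) (D.vid (D.idPro _)))
          (D.vid (D.comp m (D.idPro _)))) (D.rightUnitor m) ≍ D.rightUnitor m
      rw [D.hcomp_vid]
      exact (D.vcomp_assoc _ _ _).trans ((D.vid_vcomp _).trans (D.vid_vcomp _)))

/-- The comparison cells of the diagonal are invertible: it is a pseudo double functor. -/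
theorem diagonal_isPseudo (κ : FamilySize) (D : DoubleCategory.{u, v, p, c} X) :
    (∀ {x y z : X} (m : D.Pro x y) (n : D.Pro y z),
      (FamOp.doubleCategory.{w} κ D).IsGlobularIso ((diagonal.{w} κ D).laxator m n)) ∧
    ∀ x : X, (FamOp.doubleCategory.{w} κ D).IsGlobularIso ((diagonal.{w} κ D).unitor x) := by
  refine ⟨fun {x y z} m n => ?_, fun x => ?_⟩
  · refine ⟨⟨⟨fun _ => PUnit.unit, fun _ => rfl, fun _ => rfl⟩, fun _ => D.vid (D.comp m n)⟩,
      ?_, ?_⟩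
    · exact FamOp.Cell.hext (Category.id_comp _) (Category.id_comp _) (fun _ => rfl)
        (fun _ => D.vid_vcomp _)
    · exact FamOp.Cell.hext (Category.id_comp _) (Category.id_comp _) (fun _ => rfl)
        (fun _ => D.vid_vcomp _)
  · refine ⟨⟨⟨fun _ => PUnit.unit, fun _ => rfl, fun _ => rfl⟩, ?_⟩, ?_, ?_⟩
    · rintro ⟨⟩ ⟨⟩ _
      exact D.vid (D.idPro x)
    · refine FamOp.Cell.hext (Category.id_comp _) (Category.id_comp _) (fun _ => rfl) ?_
      rintro ⟨⟩ ⟨⟩ _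
      exact D.vid_vcomp (D.vid (D.idPro x))
    · refine FamOp.Cell.hext (Category.id_comp _) (Category.id_comp _) (fun _ => rfl) ?_
      rintro ⟨⟩ ⟨⟩ _
      exact D.vid_vcomp (D.vid (D.idPro x))

/-- The double category `D` has iso-strong products (`κ = small`), or iso-strong finite products
(`κ = finite`): the diagonal has a lax right adjoint `R` whose composition comparison
`R m ⊙ R n ⟶ R (m ⊙ n)` is invertible whenever the adjacent legs `A ⟶ J` and `J ⟵ B` of the
indexing spans are bijections, and whose identity comparisons are all invertible. -/
def HasIsoStrongProducts (κ : FamilySize) (D : DoubleCategory.{u, v, p, c} X) : Prop :=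
  ∃ R : LaxDoubleFunctor (FamOp.doubleCategory.{w} κ D) D,
    Nonempty (DoubleAdjunction (diagonal.{w} κ D) R) ∧
    (∀ {x y z : FamOp.{w} κ X} (m : FamOp.Pro D x y) (n : FamOp.Pro D y z),
      Function.Bijective m.span.r → Function.Bijective n.span.l →
        D.IsGlobularIso (R.laxator m n)) ∧
    ∀ x : FamOp.{w} κ X, D.IsGlobularIso (R.unitor x)

end Products

/-! ## The double category of spans -/

section Spans

variable {S : Type u} [Category.{v} S]

/-- Spans from `x` to `y` in a category. -/
abbrev SpanIn (x y : S) := Span (⊤ : MorphismProperty S) (⊤ : MorphismProperty S) x y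

/-- The identity span. -/
abbrev spanId (x : S) : SpanIn x x := ⟨x, 𝟙 x, 𝟙 x, trivial, trivial⟩

/-- Composition of spans by pullback. -/
noncomputable abbrev spanComp [HasPullbacks S] {x y z : S} (m : SpanIn x y) (n : SpanIn y z) :
    SpanIn x z :=
  ⟨pullback m.r n.l, pullback.fst m.r n.l ≫ m.l, pullback.snd m.r n.l ≫ n.r, trivial, trivial⟩

attribute [local simp] pullback.lift_fst pullback.lift_snd pullback.lift_fst_assoc
  pullback.lift_snd_assoc

/-- A cell between spans: a map between the apexes commuting with the legs. -/
@[ext]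
structure SpanCell {x y x' y' : S} (f : x ⟶ x') (g : y ⟶ y') (m : SpanIn x y)
    (n : SpanIn x' y') where
  hom : m.apex ⟶ n.apex
  hom_l : hom ≫ n.l = m.l ≫ f
  hom_r : hom ≫ n.r = m.r ≫ g

attribute [simp] SpanCell.hom_l SpanCell.hom_r

@[simp]
theorem SpanCell.hom_l_assoc {x y x' y' z : S} {f : x ⟶ x'} {g : y ⟶ y'} {m : SpanIn x y}
    {n : SpanIn x' y'} (α : SpanCell f g m n) (k : x' ⟶ z) :
    α.hom ≫ n.l ≫ k = m.l ≫ f ≫ k := by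
  rw [← Category.assoc, α.hom_l, Category.assoc]

@[simp]
theorem SpanCell.hom_r_assoc {x y x' y' z : S} {f : x ⟶ x'} {g : y ⟶ y'} {m : SpanIn x y}
    {n : SpanIn x' y'} (α : SpanCell f g m n) (k : y' ⟶ z) :
    α.hom ≫ n.r ≫ k = m.r ≫ g ≫ k := by
  rw [← Category.assoc, α.hom_r, Category.assoc]

theorem SpanCell.hext {x y x' y' : S} {f f' : x ⟶ x'} {g g' : y ⟶ y'} {m : SpanIn x y}
    {n : SpanIn x' y'} {α : SpanCell f g m n} {β : SpanCell f' g' m n} (hf : f = f')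
    (hg : g = g') (h : α.hom = β.hom) : α ≍ β := by
  subst hf hg
  exact heq_of_eq (SpanCell.ext h)

/-- The double category of spans in a category with pullbacks: objects and arrows are those of the
category, proarrows are spans, composed by pullback, and cells are maps of spans. -/
noncomputable def spanDoubleCategory (S : Type u) [Category.{v} S] [HasPullbacks S] :
    DoubleCategory.{u, v, max u v, v} S where
  Pro x y := SpanIn x y
  Cell f g m n := SpanCell f g m n
  vid m := ⟨𝟙 _, by simp, by simp⟩
  vcomp α β := ⟨α.hom ≫ β.hom, by simp, by simp⟩
  vid_vcomp α := SpanCell.hext (by simp) (by simp) (by simp)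
  vcomp_vid α := SpanCell.hext (by simp) (by simp) (by simp)
  vcomp_assoc α β γ := SpanCell.hext (by simp) (by simp) (by simp)
  idPro x := spanId x
  idCell f := ⟨f, by simp, by simp⟩
  idCell_id x := rfl
  idCell_comp f f' := rfl
  comp m n := spanComp m n
  hcomp {_ _ _ _ _ _ _ _ _ m n m' n'} α β :=
    ⟨pullback.lift (f := m'.r) (g := n'.l) (pullback.fst m.r n.l ≫ α.hom)
      (pullback.snd m.r n.l ≫ β.hom) (by simp [pullback.condition_assoc]), by simp, by simp⟩
  hcomp_vid m n := SpanCell.ext (by apply pullback.hom_ext <;> simp)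
  hcomp_vcomp α β α' β' := SpanCell.ext (by apply pullback.hom_ext <;> simp)
  assoc m n q :=
    ⟨pullback.lift (f := m.r) (g := pullback.fst n.r q.l ≫ n.l)
      (pullback.fst (pullback.snd m.r n.l ≫ n.r) q.l ≫ pullback.fst m.r n.l)
      (pullback.lift (pullback.fst (pullback.snd m.r n.l ≫ n.r) q.l ≫ pullback.snd m.r n.l)
        (pullback.snd (pullback.snd m.r n.l ≫ n.r) q.l) (by simp [pullback.condition]))
      (by simp [pullback.condition]), by simp, by simp⟩
  assocInv m n q :=
    ⟨pullback.lift (f := pullback.snd m.r n.l ≫ n.r) (g := q.l)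
      (pullback.lift (pullback.fst m.r (pullback.fst n.r q.l ≫ n.l))
        (pullback.snd m.r (pullback.fst n.r q.l ≫ n.l) ≫ pullback.fst n.r q.l)
        (by simp [pullback.condition]))
      (pullback.snd m.r (pullback.fst n.r q.l ≫ n.l) ≫ pullback.snd n.r q.l)
      (by simp [pullback.condition]), by simp, by simp⟩
  assoc_assocInv m n q := SpanCell.hext (by simp) (by simp) (by
    apply pullback.hom_ext
    · apply pullback.hom_ext <;> simp
    · simp)
  assocInv_assoc m n q := SpanCell.hext (by simp) (by simp) (by
    apply pullback.hom_ext
    · simp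
    · apply pullback.hom_ext <;> simp)
  assoc_naturality α β γ := SpanCell.hext (by simp) (by simp) (by
    apply pullback.hom_ext
    · simp
    · apply pullback.hom_ext <;> simp)
  leftUnitor m := ⟨pullback.snd (𝟙 _) m.l, by simp [← pullback.condition], by simp⟩
  leftUnitorInv m := ⟨pullback.lift (f := 𝟙 _) (g := m.l) m.l (𝟙 _) (by simp), by simp, by simp⟩
  leftUnitor_leftUnitorInv m := SpanCell.hext (by simp) (by simp) (by
    apply pullback.hom_ext
    · simp [← pullback.condition]
    · simp)
  leftUnitorInv_leftUnitor m := SpanCell.hext (by simp) (by simp) (by simp)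
  leftUnitor_naturality α := SpanCell.hext (by simp) (by simp) (by simp)
  rightUnitor m := ⟨pullback.fst m.r (𝟙 _), by simp, by simp [pullback.condition]⟩
  rightUnitorInv m := ⟨pullback.lift (f := m.r) (g := 𝟙 _) (𝟙 _) m.r (by simp), by simp, by simp⟩
  rightUnitor_rightUnitorInv m := SpanCell.hext (by simp) (by simp) (by
    apply pullback.hom_ext
    · simp
    · simp [pullback.condition])
  rightUnitorInv_rightUnitor m := SpanCell.hext (by simp) (by simp) (by simp)
  rightUnitor_naturality α := SpanCell.hext (by simp) (by simp) (by simp)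
  pentagon m n q r := SpanCell.hext (by simp) (by simp) (by
    apply pullback.hom_ext
    · simp
    · apply pullback.hom_ext
      · simp
      · apply pullback.hom_ext <;> simp)
  triangle m n := SpanCell.hext (by simp) (by simp) (by
    apply pullback.hom_ext
    · simp
    · simp)

end Spans

/-! The product of a family of objects is its ordinary product. The product of a family of spans `m
a` from `x (l a)` to `y (r a)` has as apex the limit of all the members together with the feet `∏ x`
and `∏ y`: the pullback of `∏ x ⨯ ∏ y` and `∏ (m a).apex` over `∏ (x (l a) ⨯ y (r a))`. A cell into
this product with prescribed sides amounts to a family of cells into the members (`exists_cellLift`,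
`cell_hext`). The comparison cells and the unit are therefore defined by their projections. The
coherence laws of the product functor, the unit laws and the right triangle identity are checked
after each projection; the counit, whose components are the projections, satisfies its laws
componentwise.

For the composition comparison, think in generalised elements. A point of `Π m ⊙ Π n` consists of
points of `∏ x`, `∏ y`, `∏ z`, of a point of each `m a` over the first two, and of a point of each
`n b` over the last two. A point of `Π (m ⊙ n)` consists of points of `∏ x`, `∏ z` and, for each
pair `(a, b)` over a common `j`, of points of `m a` and `n b` with the same foot in `y j`. If both
legs to the middle index set are bijections, there is exactly one pair over each `j`, and each `a`
and each `b` lies in exactly one pair; the point of `∏ y` is recovered from the common feet. Hence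
the comparison is invertible (`laxator_isGlobularIso`).

For normality, the identity family has an identity span as a member at every index, which forces the
two legs of its product to coincide (`unitor_isGlobularIso`). -/

/-- A category has products of all families of objects indexed by sets of a given size. -/
class HasFamilyProducts (κ : FamilySize) (S : Type u) [Category.{v} S] : Prop where
  hasProductsOfShape : ∀ I : Type w, κ.Admits I → HasProductsOfShape I S

noncomputable section

/-! ### Limits of families of spans over a pair of objects -/

namespace SpanLimit

variable {S : Type u} [Category.{v} S] [HasFiniteLimits S] {A : Type w} [HasProductsOfShape A S]
  {x y : S} {x' y' : A → S} (p : ∀ a, x ⟶ x' a) (q : ∀ a, y ⟶ y' a)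
  (m : ∀ a, SpanIn (x' a) (y' a))

/-- The legs of a family of spans, paired. -/
def legs : (∏ᶜ fun a => (m a).apex) ⟶ ∏ᶜ fun a => x' a ⨯ y' a :=
  Pi.lift fun a => Pi.π (fun a => (m a).apex) a ≫ prod.lift (m a).l (m a).r

/-- The projections to the feet of a family of spans, paired. -/
def feet : x ⨯ y ⟶ ∏ᶜ fun a => x' a ⨯ y' a :=
  Pi.lift fun a => prod.map (p a) (q a)

/-- The limit of a family of spans over a pair of objects `x` and `y`. -/
abbrev apex : S := pullback (feet p q) (legs m)

/-- The projection to the left object. -/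
def left : apex p q m ⟶ x := pullback.fst (feet p q) (legs m) ≫ prod.fst

/-- The projection to the right object. -/
def right : apex p q m ⟶ y := pullback.fst (feet p q) (legs m) ≫ prod.snd

/-- The projections to the apexes. -/
def proj (a : A) : apex p q m ⟶ (m a).apex :=
  pullback.snd (feet p q) (legs m) ≫ Pi.π (fun a => (m a).apex) a

/-- The pullback square read at the component `a`; its two coordinates are `proj_l` and `proj_r`. -/
theorem proj_lift (a : A) : proj p q m a ≫ prod.lift (m a).l (m a).r =
    pullback.fst (feet p q) (legs m) ≫ prod.map (p a) (q a) := by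
  have h₁ : legs m ≫ Pi.π _ a = _ := Pi.lift_π _ a
  have h₂ : feet p q ≫ Pi.π _ a = _ := Pi.lift_π _ a
  rw [proj, Category.assoc, ← h₁, ← h₂, pullback.condition_assoc]

theorem proj_l (a : A) : proj p q m a ≫ (m a).l = left p q m ≫ p a := by
  have h := congrArg (· ≫ prod.fst) (proj_lift p q m a)
  simpa only [left, Category.assoc, prod.lift_fst, prod.map_fst] using h

theorem proj_r (a : A) : proj p q m a ≫ (m a).r = right p q m ≫ q a := by
  have h := congrArg (· ≫ prod.snd) (proj_lift p q m a)
  simpa only [right, Category.assoc, prod.lift_snd, prod.map_snd] using h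

variable {p q m} {t : S}

/-- Uniqueness for the limit: a map into the pullback is tested on `x ⨯ y` and on the product of the
apexes. The hypotheses on `left` and `right` do not follow from the one on `proj`, for instance when
`A` is empty and the apex is just `x ⨯ y`. -/
theorem hom_ext {f g : t ⟶ apex p q m} (hl : f ≫ left p q m = g ≫ left p q m)
    (hr : f ≫ right p q m = g ≫ right p q m) (h : ∀ a, f ≫ proj p q m a = g ≫ proj p q m a) :
    f = g := by
  simp only [left, right, proj, ← Category.assoc] at hl hr h
  exact pullback.hom_ext (Limits.prod.hom_ext hl hr) (Pi.hom_ext _ _ h)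

/-- Existence for the same limit: the leg equations of the `h a` are, component by component, the
commutativity needed to map into the pullback. -/
theorem exists_lift (f : t ⟶ x) (g : t ⟶ y) (h : ∀ a, t ⟶ (m a).apex)
    (hl : ∀ a, h a ≫ (m a).l = f ≫ p a) (hr : ∀ a, h a ≫ (m a).r = g ≫ q a) :
    ∃ k : t ⟶ apex p q m, k ≫ left p q m = f ∧ k ≫ right p q m = g ∧
      ∀ a, k ≫ proj p q m a = h a := by
  have w : prod.lift f g ≫ feet p q = Pi.lift h ≫ legs m := Pi.hom_ext _ _ fun a => by
    simp [feet, legs, hl, hr]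
  refine ⟨pullback.lift _ _ w, ?_, ?_, fun a => ?_⟩
  · rw [left, pullback.lift_fst_assoc, prod.lift_fst]
  · rw [right, pullback.lift_fst_assoc, prod.lift_snd]
  · rw [proj, pullback.lift_snd_assoc, Pi.lift_π]

end SpanLimit

namespace SpanProduct

variable {S : Type u} [Category.{v} S] {κ : FamilySize} [HasFamilyProducts.{w} κ S]

/-! ### Products of families of objects -/

instance hasProduct_obj (x : FamOp.{w} κ S) : HasProduct x.obj :=
  have := HasFamilyProducts.hasProductsOfShape (κ := κ) (S := S) x.I x.admits
  inferInstance

/-- The product of a family of objects. -/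
def obj (x : FamOp.{w} κ S) : S := ∏ᶜ x.obj

/-- The projections of the product of a family of objects. -/
def π (x : FamOp.{w} κ S) (i : x.I) : obj x ⟶ x.obj i := Pi.π x.obj i

/-- The morphism to a product with given components. -/
def lift {x : FamOp.{w} κ S} {t : S} (f : ∀ i, t ⟶ x.obj i) : t ⟶ obj x := Pi.lift f

@[simp]
theorem lift_π {x : FamOp.{w} κ S} {t : S} (f : ∀ i, t ⟶ x.obj i) (i : x.I) :
    lift f ≫ π x i = f i :=
  Pi.lift_π f i

@[simp]
theorem lift_π_assoc {x : FamOp.{w} κ S} {t s : S} (f : ∀ i, t ⟶ x.obj i) (i : x.I)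
    (h : x.obj i ⟶ s) : lift f ≫ π x i ≫ h = f i ≫ h := by
  rw [← Category.assoc, lift_π]

theorem hom_ext {x : FamOp.{w} κ S} {t : S} {f g : t ⟶ obj x}
    (h : ∀ i, f ≫ π x i = g ≫ π x i) : f = g :=
  Pi.hom_ext f g h

/-- The product of a morphism of families of objects. -/
def map {x y : FamOp.{w} κ S} (f : x ⟶ y) : obj x ⟶ obj y := lift fun j => π x (f.idx j) ≫ f.hom j

@[simp]
theorem map_π {x y : FamOp.{w} κ S} (f : x ⟶ y) (j : y.I) :
    map f ≫ π y j = π x (f.idx j) ≫ f.hom j :=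
  lift_π _ _

@[simp]
theorem map_π_assoc {x y : FamOp.{w} κ S} (f : x ⟶ y) (j : y.I) {s : S} (h : y.obj j ⟶ s) :
    map f ≫ π y j ≫ h = π x (f.idx j) ≫ f.hom j ≫ h :=
  (lift_π_assoc _ _ _).trans (Category.assoc _ _ _)

theorem map_id (x : FamOp.{w} κ S) : map (𝟙 x) = 𝟙 (obj x) :=
  hom_ext fun i => (map_π _ i).trans ((Category.comp_id _).trans (Category.id_comp _).symm)

theorem map_comp {x y z : FamOp.{w} κ S} (f : x ⟶ y) (g : y ⟶ z) :
    map (f ≫ g) = map f ≫ map g :=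
  hom_ext fun k => by
    rw [map_π, Category.assoc, map_π, map_π_assoc]
    rfl

/-- The product functor on families of objects. -/
def base (κ : FamilySize) (S : Type u) [Category.{v} S] [HasFamilyProducts.{w} κ S] :
    FamOp.{w} κ S ⥤ S where
  obj := obj
  map := map
  map_id := map_id
  map_comp := map_comp

/-- The singleton family on an object. -/
abbrev single (κ : FamilySize) (x : S) : FamOp.{w} κ S := (diagonalBase.{w} κ S).obj x

/-- The morphism from an object to its power by a singleton. -/
def diag (κ : FamilySize) [HasFamilyProducts.{w} κ S] (x : S) : x ⟶ obj (single.{w} κ x) :=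
  lift (x := single κ x) fun _ => 𝟙 x

theorem diag_π (x : S) (i : (single.{w} κ x).I) : diag.{w} κ x ≫ π (single κ x) i = 𝟙 x :=
  lift_π (x := single κ x) _ _

theorem diag_π_assoc (x : S) (i : (single.{w} κ x).I) {s : S} (h : x ⟶ s) :
    diag.{w} κ x ≫ π (single κ x) i ≫ h = h :=
  (lift_π_assoc (x := single κ x) _ _ _).trans (Category.id_comp _)

/-- The projections of a product, as a morphism of families. -/
def eval (x : FamOp.{w} κ S) : single κ (obj x) ⟶ x := ⟨fun _ => PUnit.unit, fun i => π x i⟩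

theorem diag_naturality {x y : S} (f : x ⟶ y) :
    f ≫ diag.{w} κ y = diag κ x ≫ map ((diagonalBase κ S).map f) :=
  hom_ext (x := single κ y) fun i =>
    (Category.assoc _ _ _).trans <| (congrArg (f ≫ ·) (diag_π y i)).trans <|
      (Category.comp_id _).trans <| (diag_π_assoc x i f).symm.trans <|
        (congrArg (diag κ x ≫ ·) (map_π ((diagonalBase κ S).map f) i)).symm.trans
          (Category.assoc _ _ _).symm

/-- Comparison cells have identity sides, so both sides of the unit and counit laws have boundaries
that differ only by identities. This lemma and the next two absorb them. -/
theorem diag_comp_map_id (x : S) :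
    diag.{w} κ x = diag κ x ≫ 𝟙 _ ≫ map (𝟙 (single κ x)) := by
  rw [map_id, Category.comp_id, Category.comp_id]

theorem map_id_comp_eval (x : FamOp.{w} κ S) :
    (𝟙 _ ≫ (diagonalBase κ S).map (𝟙 (obj x))) ≫ eval x = eval x := by
  rw [CategoryTheory.Functor.map_id, Category.id_comp, Category.id_comp]

theorem id_comp_comp_π (x : FamOp.{w} κ S) (i : x.I) :
    (𝟙 (obj x) ≫ 𝟙 (obj x)) ≫ π x i = π x i := by
  rw [Category.id_comp, Category.id_comp]

theorem diag_map_eval (x : FamOp.{w} κ S) : diag κ (obj x) ≫ map (eval x) = 𝟙 (obj x) :=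
  hom_ext fun i => (Category.assoc _ _ _).trans <|
    (congrArg (diag κ (obj x) ≫ ·) (map_π (eval x) i)).trans <|
      (diag_π_assoc (obj x) _ _).trans (Category.id_comp _).symm

/-- The diagonal functor is left adjoint to the product functor. -/
def adjunction (κ : FamilySize) (S : Type u) [Category.{v} S] [HasFamilyProducts.{w} κ S] :
    diagonalBase.{w} κ S ⊣ base κ S where
  unit := { app := diag κ, naturality := fun _ _ f => diag_naturality f }
  counit :=
    { app := eval
      naturality := fun _ _ f => FamOp.Hom.ext rfl (heq_of_eq (funext fun j => map_π f j)) }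
  left_triangle_components x :=
    FamOp.Hom.ext rfl (heq_of_eq (funext fun j => diag_π x j))
  right_triangle_components x := diag_map_eval x

/-! ### Products of families of spans -/

variable [HasFiniteLimits S]

/-- A family of spans in a category. -/
abbrev FamSpan (x y : FamOp.{w} κ S) := FamOp.Pro (spanDoubleCategory S) x y

/-- The member of a family of spans at an element of the indexing span. -/
def FamSpan.at {x y : FamOp.{w} κ S} (m : FamSpan x y) {i : x.I} {j : y.I}
    (e : m.span.Elt i j) : SpanIn (x.obj i) (y.obj j) := m.pro e

instance hasProductsOfShape_apex {x y : FamOp.{w} κ S} (m : FamSpan x y) :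
    HasProductsOfShape m.span.apex S :=
  HasFamilyProducts.hasProductsOfShape m.span.apex m.span.admits

/-- The apex of the product of a family of spans. -/
def apex {x y : FamOp.{w} κ S} (m : FamSpan x y) : S :=
  SpanLimit.apex (fun a => π x (m.span.l a)) (fun a => π y (m.span.r a))
    fun a => m.at ⟨a, rfl, rfl⟩

/-- The left leg of the product of a family of spans. -/
def left {x y : FamOp.{w} κ S} (m : FamSpan x y) : apex m ⟶ obj x := SpanLimit.left _ _ _

/-- The right leg of the product of a family of spans. -/
def right {x y : FamOp.{w} κ S} (m : FamSpan x y) : apex m ⟶ obj y := SpanLimit.right _ _ _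

/-- The projections from the apex of the product of a family of spans. -/
def proj {x y : FamOp.{w} κ S} (m : FamSpan x y) {i : x.I} {j : y.I} (e : m.span.Elt i j) :
    apex m ⟶ (m.at e).apex :=
  -- The indices `i`, `j` are kept free so that the equations placing `a` over them can be
  -- eliminated; at `⟨a, rfl, rfl⟩` the result reduces to `SpanLimit.proj`.
  have aux : ∀ {i : x.I} {j : y.I} (a : m.span.apex) (h : m.span.l a = i) (h' : m.span.r a = j),
      apex m ⟶ (m.at ⟨a, h, h'⟩).apex := by
    rintro _ _ a rfl rfl
    exact SpanLimit.proj _ _ (fun a => m.at ⟨a, rfl, rfl⟩) a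
  aux e.1 e.2.1 e.2.2

@[simp]
theorem proj_l {x y : FamOp.{w} κ S} (m : FamSpan x y) {i : x.I} {j : y.I}
    (e : m.span.Elt i j) : proj m e ≫ (m.at e).l = left m ≫ π x i := by
  obtain ⟨a, rfl, rfl⟩ := e
  exact SpanLimit.proj_l _ _ (fun a => m.at ⟨a, rfl, rfl⟩) a

@[simp]
theorem proj_r {x y : FamOp.{w} κ S} (m : FamSpan x y) {i : x.I} {j : y.I}
    (e : m.span.Elt i j) : proj m e ≫ (m.at e).r = right m ≫ π y j := by
  obtain ⟨a, rfl, rfl⟩ := e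
  exact SpanLimit.proj_r _ _ (fun a => m.at ⟨a, rfl, rfl⟩) a

/-- The product of a family of spans. -/
def span {x y : FamOp.{w} κ S} (m : FamSpan x y) : SpanIn (obj x) (obj y) :=
  ⟨apex m, left m, right m, trivial, trivial⟩

/-- The projections of the product of a family of spans. -/
def projCell {x y : FamOp.{w} κ S} (m : FamSpan x y) {i : x.I} {j : y.I} (e : m.span.Elt i j) :
    SpanCell (π x i) (π y j) (span m) (m.at e) :=
  ⟨proj m e, proj_l m e, proj_r m e⟩

section

variable {x y : FamOp.{w} κ S} {m : FamSpan x y} {a b : S} {n : SpanIn a b}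

/-- The existence half of the universal property, at the level of cells. Every element of the
indexing span has the form `⟨a, rfl, rfl⟩`, so the lift over the apex already has all the required
projections. -/
theorem exists_cellLift (f : a ⟶ obj x) (g : b ⟶ obj y)
    (h : ∀ {i : x.I} {j : y.I} (e : m.span.Elt i j),
      SpanCell (f ≫ π x i) (g ≫ π y j) n (m.at e)) :
    ∃ α : SpanCell f g n (span m), ∀ {i : x.I} {j : y.I} (e : m.span.Elt i j),
      α.hom ≫ (projCell m e).hom = (h e).hom := by
  obtain ⟨k, h₁, h₂, h₃⟩ := SpanLimit.exists_lift (m := fun a => m.at ⟨a, rfl, rfl⟩) (n.l ≫ f)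
    (n.r ≫ g) (fun a => (h ⟨a, rfl, rfl⟩).hom)
    (fun a => (h ⟨a, rfl, rfl⟩).hom_l.trans (Category.assoc _ _ _).symm)
    (fun a => (h ⟨a, rfl, rfl⟩).hom_r.trans (Category.assoc _ _ _).symm)
  refine ⟨⟨k, h₁, h₂⟩, ?_⟩
  rintro _ _ ⟨a, rfl, rfl⟩
  exact h₃ a

/-- The cell to a product of spans with given components. -/
def cellLift (f : a ⟶ obj x) (g : b ⟶ obj y)
    (h : ∀ {i : x.I} {j : y.I} (e : m.span.Elt i j),
      SpanCell (f ≫ π x i) (g ≫ π y j) n (m.at e)) : SpanCell f g n (span m) :=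
  -- The choice is harmless: by `cell_hext` the sides and the projections determine the cell.
  (exists_cellLift f g h).choose

theorem cellLift_proj {f : a ⟶ obj x} {g : b ⟶ obj y}
    {h : ∀ {i : x.I} {j : y.I} (e : m.span.Elt i j),
      SpanCell (f ≫ π x i) (g ≫ π y j) n (m.at e)} {i : x.I} {j : y.I} (e : m.span.Elt i j) :
    (cellLift f g h).hom ≫ (projCell m e).hom = (h e).hom :=
  (exists_cellLift f g h).choose_spec e

theorem cell_hom_ext {t : S} {f g : t ⟶ apex m} (hl : f ≫ left m = g ≫ left m)
    (hr : f ≫ right m = g ≫ right m)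
    (h : ∀ a, f ≫ (projCell m ⟨a, rfl, rfl⟩).hom = g ≫ (projCell m ⟨a, rfl, rfl⟩).hom) : f = g :=
  SpanLimit.hom_ext hl hr h

/-- Equal sides already force agreement on both legs, so only the projections remain to be compared.
This reduces each coherence law of the product functor to a computation with projections. -/
theorem cell_hext {f f' : a ⟶ obj x} {g g' : b ⟶ obj y} {α : SpanCell f g n (span m)}
    {β : SpanCell f' g' n (span m)} (hf : f = f') (hg : g = g')
    (h : ∀ a, α.hom ≫ (projCell m ⟨a, rfl, rfl⟩).hom = β.hom ≫ (projCell m ⟨a, rfl, rfl⟩).hom) :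
    α ≍ β := by
  subst hf hg
  exact SpanCell.hext rfl rfl (cell_hom_ext (α.hom_l.trans β.hom_l.symm)
    (α.hom_r.trans β.hom_r.symm) h)

end

end SpanProduct

/-! ### Cells of spans handled through their underlying maps in `S`. -/

namespace SpanCell

variable {S : Type u} [Category.{v} S]

/-- A cell between spans with its sides replaced by equal ones. -/
def cast {x y x' y' : S} {f f' : x ⟶ x'} {g g' : y ⟶ y'} {m : SpanIn x y} {n : SpanIn x' y'}
    (α : SpanCell f g m n) (hf : f = f') (hg : g = g') : SpanCell f' g' m n :=
  ⟨α.hom, by rw [α.hom_l, hf], by rw [α.hom_r, hg]⟩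

/-- The identity cell of a span. -/
def vid {x y : S} (m : SpanIn x y) : SpanCell (𝟙 x) (𝟙 y) m m := ⟨𝟙 _, by simp, by simp⟩

/-- Vertical composition of cells between spans. -/
def vcomp {x y x' y' x'' y'' : S} {f : x ⟶ x'} {g : y ⟶ y'} {f' : x' ⟶ x''} {g' : y' ⟶ y''}
    {m : SpanIn x y} {n : SpanIn x' y'} {q : SpanIn x'' y''} (α : SpanCell f g m n)
    (β : SpanCell f' g' n q) : SpanCell (f ≫ f') (g ≫ g') m q :=
  ⟨α.hom ≫ β.hom, by simp, by simp⟩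

/-- Converse of `SpanCell.hext`: it turns a heterogeneous law of `spanDoubleCategory` into an
equation between maps of `S`. -/
theorem hom_eq_of_heq {x y x' y' : S} {f f' : x ⟶ x'} {g g' : y ⟶ y'} {m : SpanIn x y}
    {n : SpanIn x' y'} {α : SpanCell f g m n} {β : SpanCell f' g' m n} (hf : f = f')
    (hg : g = g') (h : α ≍ β) : α.hom = β.hom := by
  subst hf hg h
  rfl

variable [HasPullbacks S]

/-- External composition of cells between spans. -/
def hcomp {x y z x' y' z' : S} {f : x ⟶ x'} {g : y ⟶ y'} {h : z ⟶ z'} {m : SpanIn x y}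
    {n : SpanIn y z} {m' : SpanIn x' y'} {n' : SpanIn y' z'} (α : SpanCell f g m m')
    (β : SpanCell g h n n') : SpanCell f h (spanComp m n) (spanComp m' n') :=
  (spanDoubleCategory S).hcomp α β

theorem hcomp_fst {x y z x' y' z' : S} {f : x ⟶ x'} {g : y ⟶ y'} {h : z ⟶ z'} {m : SpanIn x y}
    {n : SpanIn y z} {m' : SpanIn x' y'} {n' : SpanIn y' z'} (α : SpanCell f g m m')
    (β : SpanCell g h n n') :
    (hcomp α β).hom ≫ pullback.fst m'.r n'.l = pullback.fst m.r n.l ≫ α.hom :=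
  pullback.lift_fst _ _ _

theorem hcomp_snd {x y z x' y' z' : S} {f : x ⟶ x'} {g : y ⟶ y'} {h : z ⟶ z'} {m : SpanIn x y}
    {n : SpanIn y z} {m' : SpanIn x' y'} {n' : SpanIn y' z'} (α : SpanCell f g m m')
    (β : SpanCell g h n n') :
    (hcomp α β).hom ≫ pullback.snd m'.r n'.l = pullback.snd m.r n.l ≫ β.hom :=
  pullback.lift_snd _ _ _

/-- Interchange for underlying maps. The sides of `α''` and `β''` are arbitrary and only the
underlying maps are constrained, so no transport along equalities of sides is needed. -/
theorem hcomp_hom_comp {x y z x' y' z' x'' y'' z'' : S} {f : x ⟶ x'} {g : y ⟶ y'} {h : z ⟶ z'}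
    {f' : x' ⟶ x''} {g' : y' ⟶ y''} {h' : z' ⟶ z''} {f'' : x ⟶ x''} {g'' : y ⟶ y''}
    {h'' : z ⟶ z''} {m : SpanIn x y} {n : SpanIn y z} {m' : SpanIn x' y'} {n' : SpanIn y' z'}
    {m'' : SpanIn x'' y''} {n'' : SpanIn y'' z''} {α : SpanCell f g m m'} {β : SpanCell g h n n'}
    {α' : SpanCell f' g' m' m''} {β' : SpanCell g' h' n' n''} {α'' : SpanCell f'' g'' m m''}
    {β'' : SpanCell g'' h'' n n''} (hα : α.hom ≫ α'.hom = α''.hom)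
    (hβ : β.hom ≫ β'.hom = β''.hom) :
    (hcomp α β).hom ≫ (hcomp α' β').hom = (hcomp α'' β'').hom := by
  apply pullback.hom_ext
  · rw [Category.assoc, hcomp_fst, hcomp_fst, ← hα, ← Category.assoc, hcomp_fst, Category.assoc]
  · rw [Category.assoc, hcomp_snd, hcomp_snd, ← hβ, ← Category.assoc, hcomp_snd, Category.assoc]

/-- The associator of spans. -/
def assoc {x y z t : S} (m : SpanIn x y) (n : SpanIn y z) (q : SpanIn z t) :
    SpanCell (𝟙 x) (𝟙 t) (spanComp (spanComp m n) q) (spanComp m (spanComp n q)) :=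
  (spanDoubleCategory S).assoc m n q

theorem assoc_naturality {x y z t x' y' z' t' : S} {f : x ⟶ x'} {g : y ⟶ y'} {h : z ⟶ z'}
    {k : t ⟶ t'} {m : SpanIn x y} {n : SpanIn y z} {q : SpanIn z t} {m' : SpanIn x' y'}
    {n' : SpanIn y' z'} {q' : SpanIn z' t'} (α : SpanCell f g m m') (β : SpanCell g h n n')
    (γ : SpanCell h k q q') :
    (hcomp (hcomp α β) γ).hom ≫ (assoc m' n' q').hom =
      (assoc m n q).hom ≫ (hcomp α (hcomp β γ)).hom :=
  hom_eq_of_heq (α := vcomp (hcomp (hcomp α β) γ) (assoc m' n' q'))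
    (β := vcomp (assoc m n q) (hcomp α (hcomp β γ)))
    ((Category.comp_id _).trans (Category.id_comp _).symm)
    ((Category.comp_id _).trans (Category.id_comp _).symm)
    ((spanDoubleCategory S).assoc_naturality α β γ)

end SpanCell

/-! ### The product as a lax double functor: comparison cells and coherence. -/

namespace SpanProduct

variable {S : Type u} [Category.{v} S] {κ : FamilySize} [HasFamilyProducts.{w} κ S]
  [HasFiniteLimits S]

/-- The component of a cell between families of spans at an element of the indexing span. -/
def cellAt {x y x' y' : FamOp.{w} κ S} {f : x ⟶ x'} {g : y ⟶ y'} {m : FamSpan x y}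
    {n : FamSpan x' y'} (α : FamOp.Cell f g m n) {k : x'.I} {l : y'.I} (b : n.span.Elt k l) :
    SpanCell (f.hom k) (g.hom l) (m.at (α.map.elt b)) (n.at b) :=
  α.cell b

/-- The product of a cell between families of spans. -/
def cell {x y x' y' : FamOp.{w} κ S} {f : x ⟶ x'} {g : y ⟶ y'} {m : FamSpan x y}
    {n : FamSpan x' y'} (α : FamOp.Cell f g m n) :
    SpanCell (map f) (map g) (span m) (span n) :=
  cellLift (map f) (map g) fun e =>
    ((projCell m (α.map.elt e)).vcomp (cellAt α e)).cast (map_π f _).symm (map_π g _).symm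

theorem cell_proj {x y x' y' : FamOp.{w} κ S} {f : x ⟶ x'} {g : y ⟶ y'} {m : FamSpan x y}
    {n : FamSpan x' y'} (α : FamOp.Cell f g m n) {k : x'.I} {l : y'.I} (e : n.span.Elt k l) :
    (cell α).hom ≫ (projCell n e).hom = (projCell m (α.map.elt e)).hom ≫ (cellAt α e).hom :=
  cellLift_proj e

/-- The composite of two families of spans. -/
abbrev famComp {x y z : FamOp.{w} κ S} (m : FamSpan x y) (n : FamSpan y z) : FamSpan x z :=
  FamOp.comp _ m n

/-- The identity family of spans. -/
abbrev famId (x : FamOp.{w} κ S) : FamSpan x x :=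
  ⟨IndexSpan.id x.I x.admits, FamOp.idFamily _ x⟩

/-- The composite of the projections of the products of two families of spans. -/
def compProj {x y z : FamOp.{w} κ S} (m : FamSpan x y) (n : FamSpan y z) {i : x.I} {k : z.I}
    (e : (famComp m n).span.Elt i k) :
    SpanCell (π x i) (π z k) (spanComp (span m) (span n)) ((famComp m n).at e) :=
  (projCell m e.fst).hcomp (projCell n e.snd)

/-- The composition comparison of the product. -/
def laxator {x y z : FamOp.{w} κ S} (m : FamSpan x y) (n : FamSpan y z) :
    SpanCell (𝟙 (obj x)) (𝟙 (obj z)) (spanComp (span m) (span n)) (span (famComp m n)) :=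
  cellLift (𝟙 _) (𝟙 _) fun e =>
    (compProj m n e).cast (Category.id_comp _).symm (Category.id_comp _).symm

theorem laxator_proj {x y z : FamOp.{w} κ S} (m : FamSpan x y) (n : FamSpan y z) {i : x.I}
    {k : z.I} (e : (famComp m n).span.Elt i k) :
    (laxator m n).hom ≫ (projCell (famComp m n) e).hom = (compProj m n e).hom :=
  cellLift_proj e

/-- The projections of an object to the members of the identity family. -/
def idProj (x : FamOp.{w} κ S) {i j : x.I} (e : (famId x).span.Elt i j) :
    SpanCell (π x i) (π x j) (spanId (obj x)) ((famId x).at e) :=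
  -- An element of the identity indexing span over `i` and `j` is an index `k` equal to both, and
  -- there the member is the identity span on `x.obj k`.
  have aux : ∀ {i j : x.I} (k : x.I) (h : k = i) (h' : k = j),
      SpanCell (π x i) (π x j) (spanId (obj x)) ((famId x).at ⟨k, h, h'⟩) := by
    rintro _ _ k rfl rfl
    exact (spanDoubleCategory S).idCell (π x k)
  aux e.1 e.2.1 e.2.2

/-- The identity comparison of the product. -/
def unitor (x : FamOp.{w} κ S) :
    SpanCell (𝟙 (obj x)) (𝟙 (obj x)) (spanId (obj x)) (span (famId x)) :=
  cellLift (𝟙 _) (𝟙 _) fun e =>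
    (idProj x e).cast (Category.id_comp _).symm (Category.id_comp _).symm

theorem unitor_proj (x : FamOp.{w} κ S) {i j : x.I} (e : (famId x).span.Elt i j) :
    (unitor x).hom ≫ (projCell (famId x) e).hom = (idProj x e).hom :=
  cellLift_proj e

theorem cell_proj_assoc {x y x' y' : FamOp.{w} κ S} {f : x ⟶ x'} {g : y ⟶ y'}
    {m : FamSpan x y} {n : FamSpan x' y'} (α : FamOp.Cell f g m n) {k : x'.I} {l : y'.I}
    (e : n.span.Elt k l) {t : S} (h : t ⟶ (span m).apex) :
    (h ≫ (cell α).hom) ≫ (projCell n e).hom =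
      (h ≫ (projCell m (α.map.elt e)).hom) ≫ (cellAt α e).hom := by
  rw [Category.assoc, cell_proj, Category.assoc]

theorem laxator_proj_assoc {x y z : FamOp.{w} κ S} (m : FamSpan x y) (n : FamSpan y z) {i : x.I}
    {k : z.I} (e : (famComp m n).span.Elt i k) {t : S}
    (h : t ⟶ (spanComp (span m) (span n)).apex) :
    (h ≫ (laxator m n).hom) ≫ (projCell (famComp m n) e).hom = h ≫ (compProj m n e).hom := by
  rw [Category.assoc, laxator_proj]

/-- After projection both sides become the external composite of two projections followed by that of
the components of `α` and `β`; interchange is applied once in each direction. -/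
theorem laxator_naturality {x y z x' y' z' : FamOp.{w} κ S} {f : x ⟶ x'} {g : y ⟶ y'}
    {h : z ⟶ z'} {m : FamSpan x y} {n : FamSpan y z} {m' : FamSpan x' y'} {n' : FamSpan y' z'}
    (α : FamOp.Cell f g m m') (β : FamOp.Cell g h n n') {i : x'.I} {k : z'.I}
    (e : (famComp m' n').span.Elt i k) :
    (((cell α).hcomp (cell β)).hom ≫ (laxator m' n').hom) ≫ (projCell (famComp m' n') e).hom =
      ((laxator m n).hom ≫
        (cell ((FamOp.doubleCategory.{w} κ (spanDoubleCategory S)).hcomp α β)).hom) ≫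
          (projCell (famComp m' n') e).hom :=
  (laxator_proj_assoc m' n' e _).trans <|
    (SpanCell.hcomp_hom_comp
      (α'' := (projCell m (α.map.elt e.fst)).vcomp (cellAt α e.fst))
      (β'' := (projCell n (β.map.elt e.snd)).vcomp (cellAt β e.snd))
      (cell_proj α e.fst) (cell_proj β e.snd)).trans <|
    (SpanCell.hcomp_hom_comp (α := projCell m (α.map.elt e.fst)) (α' := cellAt α e.fst)
      (β := projCell n (β.map.elt e.snd)) (β' := cellAt β e.snd) rfl rfl).symm.trans <|
    (congrArg (· ≫ ((cellAt α e.fst).hcomp (cellAt β e.snd)).hom)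
      (laxator_proj m n (IndexSpan.Map.elt
        ((FamOp.doubleCategory.{w} κ (spanDoubleCategory S)).hcomp α β).map e))).symm.trans
    (cell_proj_assoc ((FamOp.doubleCategory.{w} κ (spanDoubleCategory S)).hcomp α β) e _).symm

theorem unitor_naturality {x x' : FamOp.{w} κ S} (f : x ⟶ x') {i j : x'.I}
    (e : (famId x').span.Elt i j) :
    (map f ≫ (unitor x').hom) ≫ (projCell (famId x') e).hom =
      ((unitor x).hom ≫ (cell (FamOp.idCell (spanDoubleCategory S) f)).hom) ≫
        (projCell (famId x') e).hom := by
  rw [cell_proj_assoc (m := famId x) (n := famId x'), Category.assoc, unitor_proj, unitor_proj]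
  obtain ⟨k, rfl, rfl⟩ := e
  exact map_π f k

/-- Projected to one triple of members, each side is a threefold external composite of projections,
bracketed differently, with an associator after it or before it. The equation is then naturality of
the associator of spans at those three projections (`h₃`). -/
theorem laxator_assoc {x y z t : FamOp.{w} κ S} (m : FamSpan x y) (n : FamSpan y z)
    (q : FamSpan z t) {i : x.I} {l : t.I} (e : (famComp m (famComp n q)).span.Elt i l) :
    ((((laxator m n).hcomp (SpanCell.vid (span q))).hom ≫ (laxator (famComp m n) q).hom) ≫
      (cell ((FamOp.doubleCategory.{w} κ (spanDoubleCategory S)).assoc m n q)).hom) ≫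
        (projCell (famComp m (famComp n q)) e).hom =
      ((SpanCell.assoc (span m) (span n) (span q)).hom ≫
        ((SpanCell.vid (span m)).hcomp (laxator n q)).hom ≫ (laxator m (famComp n q)).hom) ≫
          (projCell (famComp m (famComp n q)) e).hom := by
  let α : FamOp.Cell (𝟙 x) (𝟙 t) (famComp (famComp m n) q) (famComp m (famComp n q)) :=
    (FamOp.doubleCategory.{w} κ (spanDoubleCategory S)).assoc m n q
  let e' : (famComp (famComp m n) q).span.Elt i l := α.map.elt e
  have h₁ : ((laxator m n).hcomp (SpanCell.vid (span q))).hom ≫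
      (compProj (famComp m n) q e').hom =
        ((compProj m n e'.fst).hcomp (projCell q e'.snd)).hom :=
    SpanCell.hcomp_hom_comp (laxator_proj m n e'.fst) (Category.id_comp _)
  have h₂ : ((SpanCell.vid (span m)).hcomp (laxator n q)).hom ≫
      (compProj m (famComp n q) e).hom =
        ((projCell m e.fst).hcomp (compProj n q e.snd)).hom :=
    SpanCell.hcomp_hom_comp (Category.id_comp _) (laxator_proj n q e.snd)
  have h₃ : ((compProj m n e'.fst).hcomp (projCell q e'.snd)).hom ≫ (cellAt α e).hom =
      (SpanCell.assoc (span m) (span n) (span q)).hom ≫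
        ((projCell m e.fst).hcomp (compProj n q e.snd)).hom :=
    SpanCell.assoc_naturality (projCell m e.fst) (projCell n e.snd.fst) (projCell q e.snd.snd)
  have h₄ := cell_proj_assoc α e
    (((laxator m n).hcomp (SpanCell.vid (span q))).hom ≫ (laxator (famComp m n) q).hom)
  have h₅ := laxator_proj_assoc (famComp m n) q e'
    ((laxator m n).hcomp (SpanCell.vid (span q))).hom
  have h₆ := laxator_proj_assoc m (famComp n q) e
    ((SpanCell.vid (span m)).hcomp (laxator n q)).hom
  have h₇ := congrArg ((SpanCell.assoc (span m) (span n) (span q)).hom ≫ ·) (h₆.trans h₂)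
  have h₈ := congrArg (· ≫ (cellAt α e).hom) (h₅.trans h₁)
  exact h₄.trans (h₈.trans (h₃.trans (h₇.symm.trans (Category.assoc _ _ _).symm)))

/-- The unitor of spans is a pullback projection, so after projection the claim is the formula for
the second coordinate of an external composite. `laxator_rightUnit` uses the first coordinate. -/
theorem laxator_leftUnit {x y : FamOp.{w} κ S} (m : FamSpan x y) {i : x.I} {j : y.I}
    (e : m.span.Elt i j) :
    ((((unitor x).hcomp (SpanCell.vid (span m))).hom ≫ (laxator (famId x) m).hom) ≫
      (cell (FamOp.leftUnitor (spanDoubleCategory S) m)).hom) ≫ (projCell m e).hom =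
        pullback.snd (𝟙 (obj x)) (left m) ≫ (projCell m e).hom := by
  obtain ⟨a, rfl, rfl⟩ := e
  have h : ((unitor x).hcomp (SpanCell.vid (span m))).hom ≫
      (compProj (famId x) m
        (IndexSpan.Map.elt (FamOp.leftUnitor (spanDoubleCategory S) m).map ⟨a, rfl, rfl⟩)).hom =
        ((idProj x ⟨m.span.l a, rfl, rfl⟩).hcomp (projCell m ⟨a, rfl, rfl⟩)).hom :=
    SpanCell.hcomp_hom_comp (unitor_proj x _) (Category.id_comp _)
  refine (cell_proj_assoc (FamOp.leftUnitor (spanDoubleCategory S) m) ⟨a, rfl, rfl⟩ _).trans ?_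
  exact (congrArg (· ≫ (cellAt (FamOp.leftUnitor (spanDoubleCategory S) m) ⟨a, rfl, rfl⟩).hom)
    ((laxator_proj_assoc _ _ _ _).trans h)).trans (SpanCell.hcomp_snd _ _)

theorem laxator_rightUnit {x y : FamOp.{w} κ S} (m : FamSpan x y) {i : x.I} {j : y.I}
    (e : m.span.Elt i j) :
    ((((SpanCell.vid (span m)).hcomp (unitor y)).hom ≫ (laxator m (famId y)).hom) ≫
      (cell (FamOp.rightUnitor (spanDoubleCategory S) m)).hom) ≫ (projCell m e).hom =
        pullback.fst (right m) (𝟙 (obj y)) ≫ (projCell m e).hom := by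
  obtain ⟨a, rfl, rfl⟩ := e
  have h : ((SpanCell.vid (span m)).hcomp (unitor y)).hom ≫
      (compProj m (famId y)
        (IndexSpan.Map.elt (FamOp.rightUnitor (spanDoubleCategory S) m).map ⟨a, rfl, rfl⟩)).hom =
        ((projCell m ⟨a, rfl, rfl⟩).hcomp (idProj y ⟨m.span.r a, rfl, rfl⟩)).hom :=
    SpanCell.hcomp_hom_comp (Category.id_comp _) (unitor_proj y _)
  refine (cell_proj_assoc (FamOp.rightUnitor (spanDoubleCategory S) m) ⟨a, rfl, rfl⟩ _).trans ?_
  exact (congrArg (· ≫ (cellAt (FamOp.rightUnitor (spanDoubleCategory S) m) ⟨a, rfl, rfl⟩).hom)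
    ((laxator_proj_assoc _ _ _ _).trans h)).trans (SpanCell.hcomp_fst _ _)

/-- The product of families of spans, as a lax double functor. -/
def functor (κ : FamilySize) (S : Type u) [Category.{v} S] [HasFamilyProducts.{w} κ S]
    [HasFiniteLimits S] :
    LaxDoubleFunctor (FamOp.doubleCategory.{w} κ (spanDoubleCategory S))
      (spanDoubleCategory S) where
  base := base κ S
  pro m := span m
  cell α := cell α
  -- The cells are named through `SpanCell` so that their underlying maps are visible; they unfold
  -- to those of `spanDoubleCategory`. The fields below do the same.
  cell_vid m := cell_hext (β := SpanCell.vid (span m)) (map_id _) (map_id _) fun a =>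
    (cell_proj (m := m) (n := m) _ _).trans
      ((Category.comp_id _).trans (Category.id_comp _).symm)
  cell_vcomp {x y x' y' x'' y'' f g f' g' m n q} α β :=
    cell_hext (β := SpanCell.vcomp (cell α) (cell β)) (map_comp _ _) (map_comp _ _) fun a =>
      (cell_proj (m := m) (n := q) _ _).trans <| (Category.assoc _ _ _).symm.trans <|
        (congrArg (· ≫ (cellAt β ⟨a, rfl, rfl⟩).hom) (cell_proj α _).symm).trans <|
          (Category.assoc _ _ _).trans <|
            (congrArg ((cell α).hom ≫ ·) (cell_proj β ⟨a, rfl, rfl⟩).symm).trans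
              (Category.assoc _ _ _).symm
  laxator m n := laxator m n
  unitor x := unitor x
  laxator_naturality {x y z x' y' z' f g h m n m' n'} α β :=
    cell_hext (α := ((cell α).hcomp (cell β)).vcomp (laxator m' n'))
      (β := (laxator m n).vcomp
        (cell ((FamOp.doubleCategory.{w} κ (spanDoubleCategory S)).hcomp α β)))
      ((Category.comp_id _).trans (Category.id_comp _).symm)
      ((Category.comp_id _).trans (Category.id_comp _).symm) fun a =>
        laxator_naturality α β ⟨a, rfl, rfl⟩
  unitor_naturality {x x'} f :=
    cell_hext (α := SpanCell.vcomp ((spanDoubleCategory S).idCell (map f)) (unitor x'))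
      (β := (unitor x).vcomp (cell (FamOp.idCell (spanDoubleCategory S) f)))
      ((Category.comp_id _).trans (Category.id_comp _).symm)
      ((Category.comp_id _).trans (Category.id_comp _).symm) fun a =>
        unitor_naturality f ⟨a, rfl, rfl⟩
  laxator_assoc {x y z t} m n q :=
    cell_hext (α := SpanCell.vcomp (SpanCell.vcomp ((laxator m n).hcomp (SpanCell.vid (span q)))
        (laxator (famComp m n) q))
          (cell ((FamOp.doubleCategory.{w} κ (spanDoubleCategory S)).assoc m n q)))
      (β := SpanCell.vcomp (SpanCell.assoc (span m) (span n) (span q))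
        (((SpanCell.vid (span m)).hcomp (laxator n q)).vcomp (laxator m (famComp n q))))
      (by rw [map_id]; simp) (by rw [map_id]; simp) fun a =>
        laxator_assoc m n q ⟨a, rfl, rfl⟩
  laxator_leftUnit m :=
    cell_hext (α := SpanCell.vcomp (SpanCell.vcomp ((unitor _).hcomp (SpanCell.vid (span m)))
        (laxator (famId _) m)) (cell (FamOp.leftUnitor (spanDoubleCategory S) m)))
      (β := (spanDoubleCategory S).leftUnitor (span m))
      (by rw [map_id]; simp) (by rw [map_id]; simp) fun a =>
        laxator_leftUnit m ⟨a, rfl, rfl⟩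
  laxator_rightUnit m :=
    cell_hext (α := SpanCell.vcomp (SpanCell.vcomp ((SpanCell.vid (span m)).hcomp (unitor _))
        (laxator m (famId _))) (cell (FamOp.rightUnitor (spanDoubleCategory S) m)))
      (β := (spanDoubleCategory S).rightUnitor (span m))
      (by rw [map_id]; simp) (by rw [map_id]; simp) fun a =>
        laxator_rightUnit m ⟨a, rfl, rfl⟩

/-! ### The adjunction -/

/-- The singleton family on a span. -/
abbrev singleSpan (κ : FamilySize) [HasFamilyProducts.{w} κ S] {x y : S} (m : SpanIn x y) :
    FamSpan (single.{w} κ x) (single.{w} κ y) :=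
  (diagonal.{w} κ (spanDoubleCategory S)).pro m

/-- The unit at a span. -/
def unit (κ : FamilySize) [HasFamilyProducts.{w} κ S] {x y : S} (m : SpanIn x y) :
    SpanCell (diag.{w} κ x) (diag.{w} κ y) m (span (singleSpan.{w} κ m)) :=
  cellLift (m := singleSpan.{w} κ m) _ _ fun {i j} _ =>
    (SpanCell.vid m).cast (diag_π x i).symm (diag_π y j).symm

theorem unit_proj {x y : S} (m : SpanIn x y) {i : (single.{w} κ x).I} {j : (single.{w} κ y).I}
    (e : (singleSpan.{w} κ m).span.Elt i j) :
    (unit.{w} κ m).hom ≫ (projCell (singleSpan.{w} κ m) e).hom = 𝟙 m.apex :=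
  cellLift_proj e

/-- The counit at a family of spans. -/
def counit {x y : FamOp.{w} κ S} (m : FamSpan x y) :
    FamOp.Cell (eval x) (eval y) (singleSpan κ (span m)) m where
  map := ⟨fun _ => PUnit.unit, fun _ => rfl, fun _ => rfl⟩
  cell e := projCell m e

theorem unit_naturality {x y x' y' : S} {f : x ⟶ x'} {g : y ⟶ y'} {m : SpanIn x y}
    {n : SpanIn x' y'} (α : SpanCell f g m n) :
    α.vcomp (unit.{w} κ n) ≍
      (unit.{w} κ m).vcomp (cell ((diagonal.{w} κ (spanDoubleCategory S)).cell α)) :=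
  cell_hext (m := singleSpan.{w} κ n) (diag_naturality f) (diag_naturality g) fun _ =>
    (Category.assoc _ _ _).trans <| (congrArg (α.hom ≫ ·) (unit_proj n _)).trans <|
      (Category.comp_id _).trans <| (Category.id_comp _).symm.trans <|
        (congrArg (· ≫ α.hom) (unit_proj.{w} (κ := κ) m _)).symm.trans
          (cell_proj_assoc (m := singleSpan.{w} κ m) (n := singleSpan.{w} κ n)
            ((diagonal.{w} κ (spanDoubleCategory S)).cell α) _ _).symm

/-- Both sides project to the identity of the composite's apex: the unit has identity projections,
and external composition preserves identity cells. -/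
theorem unit_comp {x y z : S} (m : SpanIn x y) (n : SpanIn y z) :
    unit.{w} κ (spanComp m n) ≍
      ((unit.{w} κ m).hcomp (unit.{w} κ n)).vcomp
        ((laxator (singleSpan.{w} κ m) (singleSpan.{w} κ n)).vcomp
          (cell ((diagonal.{w} κ (spanDoubleCategory S)).laxator m n))) :=
  cell_hext (m := singleSpan.{w} κ (spanComp m n)) (diag_comp_map_id x)
    (diag_comp_map_id z) fun a => by
    let lax : FamOp.Cell (𝟙 (single.{w} κ x)) (𝟙 (single κ z))
        (famComp (singleSpan κ m) (singleSpan κ n)) (singleSpan κ (spanComp m n)) :=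
      (diagonal.{w} κ (spanDoubleCategory S)).laxator m n
    let e : (singleSpan.{w} κ (spanComp m n)).span.Elt a a := ⟨a, rfl, rfl⟩
    have h₁ := cell_proj_assoc lax e (laxator (singleSpan.{w} κ m) (singleSpan.{w} κ n)).hom
    -- The component of the comparison cell of `diagonal` is an identity, which the `𝟙 _` makes
    -- explicit.
    have h₂ : _ = (_ ≫ 𝟙 _) := h₁.trans
      (congrArg (· ≫ (cellAt lax e).hom) (laxator_proj _ _ (lax.map.elt e)))
    have h₃ := h₂.trans (Category.comp_id _)
    have h₄ := congrArg (((unit.{w} κ m).hcomp (unit.{w} κ n)).hom ≫ ·) h₃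
    have h₅ : ((unit.{w} κ m).hcomp (unit.{w} κ n)).hom ≫
        (compProj _ _ (lax.map.elt e)).hom = ((SpanCell.vid m).hcomp (SpanCell.vid n)).hom :=
      SpanCell.hcomp_hom_comp (unit_proj _ _) (unit_proj _ _)
    have h₆ : ((SpanCell.vid m).hcomp (SpanCell.vid n)).hom = 𝟙 _ :=
      congrArg SpanCell.hom ((spanDoubleCategory S).hcomp_vid m n)
    exact (unit_proj _ _).trans (((Category.assoc _ _ _).trans (h₄.trans (h₅.trans h₆))).symm)

theorem unit_id (x : S) :
    unit.{w} κ (spanId x) ≍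
      SpanCell.vcomp ((spanDoubleCategory S).idCell (diag.{w} κ x))
        ((unitor (single.{w} κ x)).vcomp
          (cell ((diagonal.{w} κ (spanDoubleCategory S)).unitor x))) :=
  cell_hext (m := singleSpan.{w} κ (spanId x)) (diag_comp_map_id x) (diag_comp_map_id x) fun a => by
    let u : FamOp.Cell (𝟙 (single.{w} κ x)) (𝟙 (single κ x))
        (famId (single κ x)) (singleSpan κ (spanId x)) :=
      (diagonal.{w} κ (spanDoubleCategory S)).unitor x
    let e : (singleSpan.{w} κ (spanId x)).span.Elt a a := ⟨a, rfl, rfl⟩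
    have h₁ := cell_proj_assoc u e (unitor (single.{w} κ x)).hom
    have h₂ : _ = (_ ≫ 𝟙 _) := h₁.trans
      (congrArg (· ≫ (cellAt u e).hom) (unitor_proj _ (u.map.elt e)))
    have h₃ := congrArg (diag.{w} κ x ≫ ·) (h₂.trans (Category.comp_id _))
    exact (unit_proj _ _).trans
      (((Category.assoc _ _ _).trans (h₃.trans (diag_π x a))).symm)

/-- The product of families of spans is right adjoint to the diagonal. -/
def doubleAdjunction (κ : FamilySize) (S : Type u) [Category.{v} S] [HasFamilyProducts.{w} κ S]
    [HasFiniteLimits S] :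
    DoubleAdjunction (diagonal.{w} κ (spanDoubleCategory S)) (functor.{w} κ S) where
  adj := adjunction κ S
  unit m := unit κ m
  counit m := counit m
  unit_naturality α := unit_naturality α
  counit_naturality {x y x' y' f g m n} α := FamOp.Cell.hext
    ((adjunction κ S).counit.naturality f) ((adjunction κ S).counit.naturality g) (fun _ => rfl)
    fun {k l} e => SpanCell.hext (map_π f k) (map_π g l) (cell_proj α e)
  unit_comp m n := unit_comp m n
  unit_id x := unit_id x
  counit_comp {x y z} m n := FamOp.Cell.hext (map_id_comp_eval x) (map_id_comp_eval z)
    -- The comparison of `diagonal` contributes an identity in front of `laxator`, hence the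
    -- instance at `𝟙 _`.
    (fun _ => rfl) fun {i k} e => SpanCell.hext (id_comp_comp_π x i) (id_comp_comp_π z k)
      ((laxator_proj_assoc m n e (𝟙 _)).trans (Category.id_comp _))
  counit_id x := FamOp.Cell.hext (map_id_comp_eval x) (map_id_comp_eval x) (fun _ => rfl) (by
    rintro i _ ⟨a, rfl, rfl⟩
    exact SpanCell.hext (id_comp_comp_π x _) (id_comp_comp_π x _)
      ((Category.assoc _ _ _).trans
        ((Category.id_comp _).trans (unitor_proj x ⟨a, rfl, rfl⟩))))
  left_triangle m := FamOp.Cell.hext ((adjunction κ S).left_triangle_components _)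
    ((adjunction κ S).left_triangle_components _) (fun _ => rfl)
    fun {k l} e => SpanCell.hext (diag_π _ k) (diag_π _ l) (unit_proj m e)
  right_triangle m := cell_hext (β := SpanCell.vid (span m)) (diag_map_eval _) (diag_map_eval _)
    fun a => (cell_proj_assoc (counit m) _ _).trans <|
      congrArg (· ≫ (projCell m ⟨a, rfl, rfl⟩).hom) (unit_proj (span m) _)

/-! ### Invertibility of the comparison cells -/

theorem unitor_isGlobularIso (x : FamOp.{w} κ S) :
    (spanDoubleCategory S).IsGlobularIso (unitor x) := by
  -- The member at `k` is an identity span, so the `k`-th components of both legs equal the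
  -- projection to it. As every `k` occurs, the legs coincide and serve as the inverse.
  have h : left (famId x) = right (famId x) := hom_ext fun k =>
    (proj_l (famId x) ⟨k, rfl, rfl⟩).symm.trans (proj_r (famId x) ⟨k, rfl, rfl⟩)
  let β : SpanCell (𝟙 (obj x)) (𝟙 (obj x)) (span (famId x)) (spanId (obj x)) :=
    ⟨left (famId x), rfl, congrArg (· ≫ 𝟙 _) h⟩
  refine ⟨β, SpanCell.hext (Category.comp_id _) (Category.comp_id _)
    ((unitor x).hom_l.trans (Category.comp_id _)), ?_⟩
  refine cell_hext (α := β.vcomp (unitor x)) (β := SpanCell.vid _) (Category.comp_id _)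
    (Category.comp_id _) fun k => ?_
  refine (Category.assoc _ _ _).trans ((congrArg (β.hom ≫ ·) (unitor_proj x _)).trans ?_)
  refine (proj_l (famId x) ⟨k, rfl, rfl⟩).symm.trans ((Category.comp_id _).trans ?_)
  exact (Category.id_comp _).symm

/-! ### Composition along bijective legs. -/

section

variable {x y z : FamOp.{w} κ S} (m : FamSpan x y) (n : FamSpan y z)

/-- The element of a composite indexing span given by elements of its factors. -/
def pair {i : x.I} {j : y.I} {k : z.I} (a : m.span.Elt i j) (b : n.span.Elt j k) :
    (famComp m n).span.Elt i k :=
  ⟨⟨(a.1, j, b.1), a.2.2, b.2.1⟩, a.2.1, b.2.2⟩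

/-- The first component of the projection from the product of a composite family. -/
def fstAt {i : x.I} {j : y.I} {k : z.I} (a : m.span.Elt i j) (b : n.span.Elt j k) :
    apex (famComp m n) ⟶ (m.at a).apex :=
  (projCell (famComp m n) (pair m n a b)).hom ≫ pullback.fst (m.at a).r (n.at b).l

/-- The second component of the projection from the product of a composite family. -/
def sndAt {i : x.I} {j : y.I} {k : z.I} (a : m.span.Elt i j) (b : n.span.Elt j k) :
    apex (famComp m n) ⟶ (n.at b).apex :=
  (projCell (famComp m n) (pair m n a b)).hom ≫ pullback.snd (m.at a).r (n.at b).l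

variable {m n}

theorem fstAt_r {i : x.I} {j : y.I} {k : z.I} (a : m.span.Elt i j) (b : n.span.Elt j k) :
    fstAt m n a b ≫ (m.at a).r = sndAt m n a b ≫ (n.at b).l :=
  (Category.assoc _ _ _).trans <|
    (congrArg ((projCell (famComp m n) (pair m n a b)).hom ≫ ·) pullback.condition).trans
      (Category.assoc _ _ _).symm

theorem fstAt_l {i : x.I} {j : y.I} {k : z.I} (a : m.span.Elt i j) (b : n.span.Elt j k) :
    fstAt m n a b ≫ (m.at a).l = left (famComp m n) ≫ π x i :=
  (Category.assoc _ _ _).trans (proj_l (famComp m n) (pair m n a b))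

theorem sndAt_r {i : x.I} {j : y.I} {k : z.I} (a : m.span.Elt i j) (b : n.span.Elt j k) :
    sndAt m n a b ≫ (n.at b).r = right (famComp m n) ≫ π z k :=
  (Category.assoc _ _ _).trans (proj_r (famComp m n) (pair m n a b))

/-- Injectivity of the leg leaves at most one element over `j`, so the component at `a` cannot
depend on its partner. Without it, the product of the composite could hold several independent
points of the same `m.at a`. -/
theorem fstAt_congr (hn : Function.Injective n.span.l) {i : x.I} {j : y.I} {k k' : z.I}
    (a : m.span.Elt i j) (b : n.span.Elt j k) (b' : n.span.Elt j k') :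
    fstAt m n a b = fstAt m n a b' := by
  obtain ⟨b, hb, rfl⟩ := b
  obtain ⟨b', hb', rfl⟩ := b'
  obtain rfl : b = b' := hn (hb.trans hb'.symm)
  rfl

theorem sndAt_congr (hm : Function.Injective m.span.r) {i i' : x.I} {j : y.I} {k : z.I}
    (a : m.span.Elt i j) (a' : m.span.Elt i' j) (b : n.span.Elt j k) :
    sndAt m n a b = sndAt m n a' b := by
  obtain ⟨a, rfl, ha⟩ := a
  obtain ⟨a', rfl, ha'⟩ := a'
  obtain rfl : a = a' := hm (ha.trans ha'.symm)
  rfl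

theorem laxator_fstAt {i : x.I} {j : y.I} {k : z.I} (a : m.span.Elt i j) (b : n.span.Elt j k) :
    (laxator m n).hom ≫ fstAt m n a b =
      pullback.fst (right m) (left n) ≫ (projCell m a).hom :=
  (Category.assoc _ _ _).symm.trans <|
    (congrArg (· ≫ pullback.fst (m.at a).r (n.at b).l) (laxator_proj m n (pair m n a b))).trans
      (SpanCell.hcomp_fst (projCell m a) (projCell n b))

theorem laxator_sndAt {i : x.I} {j : y.I} {k : z.I} (a : m.span.Elt i j) (b : n.span.Elt j k) :
    (laxator m n).hom ≫ sndAt m n a b =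
      pullback.snd (right m) (left n) ≫ (projCell n b).hom :=
  (Category.assoc _ _ _).symm.trans <|
    (congrArg (· ≫ pullback.snd (m.at a).r (n.at b).l) (laxator_proj m n (pair m n a b))).trans
      (SpanCell.hcomp_snd (projCell m a) (projCell n b))

theorem laxator_isGlobularIso (hm : Function.Bijective m.span.r)
    (hn : Function.Bijective n.span.l) :
    (spanDoubleCategory S).IsGlobularIso (laxator m n) := by
  -- Surjectivity supplies a partner over every `j`; injectivity enters only through `fstAt_congr`
  -- and `sndAt_congr`.
  choose a ha using hm.2
  choose b hb using hn.2
  let A (j : y.I) : m.span.Elt (m.span.l (a j)) j := ⟨a j, rfl, ha j⟩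
  let B (j : y.I) : n.span.Elt j (n.span.r (b j)) := ⟨b j, hb j, rfl⟩
  -- The middle coordinate, absent from the legs of the product of the composite, is rebuilt at each
  -- `j` as the common foot of the two components over `j`.
  let mid : apex (famComp m n) ⟶ obj y := lift fun j => fstAt m n (A j) (B j) ≫ (m.at (A j)).r
  have hmid {i j} (e : m.span.Elt i j) : fstAt m n e (B j) ≫ (m.at e).r = mid ≫ π y j := by
    rw [lift_π, fstAt_r, fstAt_r, sndAt_congr hm.1 e (A j)]
  have hmid' {j k} (e : n.span.Elt j k) : sndAt m n (A j) e ≫ (n.at e).l = mid ≫ π y j := by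
    rw [lift_π, ← fstAt_r, fstAt_congr hn.1 (A j) e (B j)]
  -- `mid` splits the product of the composite into two spans on the same apex. Their cells to `span
  -- m` and `span n` agree on the middle leg and so pair into the inverse `β`.
  let T : SpanIn (obj x) (obj y) :=
    ⟨apex (famComp m n), left (famComp m n), mid, trivial, trivial⟩
  let T' : SpanIn (obj y) (obj z) :=
    ⟨apex (famComp m n), mid, right (famComp m n), trivial, trivial⟩
  let α₁ : SpanCell (𝟙 (obj x)) (𝟙 (obj y)) T (span m) := cellLift _ _ fun {i j} e =>
    SpanCell.cast (f := π x i) (g := π y j)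
      ⟨fstAt m n e (B j), fstAt_l e (B j), hmid e⟩
      (Category.id_comp _).symm (Category.id_comp _).symm
  let α₂ : SpanCell (𝟙 (obj y)) (𝟙 (obj z)) T' (span n) := cellLift _ _ fun {j k} e =>
    SpanCell.cast (f := π y j) (g := π z k)
      ⟨sndAt m n (A j) e, hmid' e, sndAt_r (A j) e⟩
      (Category.id_comp _).symm (Category.id_comp _).symm
  have h₁ {i j} (e : m.span.Elt i j) : α₁.hom ≫ (projCell m e).hom = fstAt m n e (B j) :=
    cellLift_proj e
  have h₂ {j k} (e : n.span.Elt j k) : α₂.hom ≫ (projCell n e).hom = sndAt m n (A j) e :=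
    cellLift_proj e
  let β : SpanCell (𝟙 (obj x)) (𝟙 (obj z)) (span (famComp m n)) (spanComp (span m) (span n)) :=
    ⟨pullback.lift α₁.hom α₂.hom (α₁.hom_r.trans α₂.hom_l.symm),
      (pullback.lift_fst_assoc _ _ _ _).trans α₁.hom_l,
      (pullback.lift_snd_assoc _ _ _ _).trans α₂.hom_r⟩
  have hβ₁ : β.hom ≫ pullback.fst (right m) (left n) = α₁.hom := pullback.lift_fst _ _ _
  have hβ₂ : β.hom ≫ pullback.snd (right m) (left n) = α₂.hom := pullback.lift_snd _ _ _
  -- Starting from a composable pair of points, the rebuilt middle coordinate is the original one.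
  have hmid_right : (laxator m n).hom ≫ mid = pullback.fst (right m) (left n) ≫ right m :=
    hom_ext fun j =>
      (Category.assoc _ _ _).trans <|
        (congrArg ((laxator m n).hom ≫ ·) (lift_π _ j)).trans <|
        (Category.assoc _ _ _).symm.trans <|
        (congrArg (· ≫ (m.at (A j)).r) (laxator_fstAt (A j) (B j))).trans <|
        (Category.assoc _ _ _).trans <|
        (congrArg (pullback.fst (right m) (left n) ≫ ·) (proj_r m (A j))).trans
          (Category.assoc _ _ _).symm
  have hl₁ : (laxator m n).hom ≫ α₁.hom = pullback.fst (right m) (left n) :=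
    cell_hom_ext
      ((Category.assoc _ _ _).trans <|
        (congrArg ((laxator m n).hom ≫ ·) (α₁.hom_l.trans (Category.comp_id _))).trans <|
        (laxator m n).hom_l.trans (Category.comp_id _))
      ((Category.assoc _ _ _).trans <|
        (congrArg ((laxator m n).hom ≫ ·) (α₁.hom_r.trans (Category.comp_id _))).trans hmid_right)
      fun a => (Category.assoc _ _ _).trans <|
        (congrArg ((laxator m n).hom ≫ ·) (h₁ _)).trans (laxator_fstAt _ _)
  have hl₂ : (laxator m n).hom ≫ α₂.hom = pullback.snd (right m) (left n) :=
    cell_hom_ext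
      ((Category.assoc _ _ _).trans <|
        (congrArg ((laxator m n).hom ≫ ·) (α₂.hom_l.trans (Category.comp_id _))).trans <|
        hmid_right.trans pullback.condition)
      ((Category.assoc _ _ _).trans <|
        (congrArg ((laxator m n).hom ≫ ·) (α₂.hom_r.trans (Category.comp_id _))).trans <|
        (laxator m n).hom_r.trans (Category.comp_id _))
      fun a => (Category.assoc _ _ _).trans <|
        (congrArg ((laxator m n).hom ≫ ·) (h₂ _)).trans (laxator_sndAt _ _)
  refine ⟨β, SpanCell.hext (Category.comp_id _) (Category.comp_id _) ?_,
    cell_hext (α := β.vcomp (laxator m n)) (β := SpanCell.vid _) (Category.comp_id _)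
      (Category.comp_id _) fun e => ?_⟩
  · apply pullback.hom_ext
    · exact (Category.assoc _ _ _).trans <| (congrArg (_ ≫ ·) hβ₁).trans <|
        hl₁.trans (Category.id_comp _).symm
    · exact (Category.assoc _ _ _).trans <| (congrArg (_ ≫ ·) hβ₂).trans <|
        hl₂.trans (Category.id_comp _).symm
  -- For the other composite, each projection lands in a pullback of two members and is checked on
  -- both factors. There `β` uses the chosen partners, which are exchanged for the actual ones `c`
  -- and `d`.
  · refine ((laxator_proj_assoc m n _ _).trans ?_).trans (Category.id_comp _).symm
    obtain ⟨⟨s, j, t⟩, hs, ht⟩ := e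
    let c : m.span.Elt (m.span.l s) j := ⟨s, rfl, hs⟩
    let d : n.span.Elt j (n.span.r t) := ⟨t, ht, rfl⟩
    have hc₁ := SpanCell.hcomp_fst (projCell m c) (projCell n d)
    have hc₂ := SpanCell.hcomp_snd (projCell m c) (projCell n d)
    apply pullback.hom_ext (f := (m.at c).r) (g := (n.at d).l)
    · refine (Category.assoc _ _ _).trans ((congrArg (β.hom ≫ ·) hc₁).trans ?_)
      refine (Category.assoc _ _ _).symm.trans
        ((congrArg (· ≫ (projCell m c).hom) hβ₁).trans ?_)
      exact (h₁ c).trans (fstAt_congr hn.1 c (B _) d)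
    · refine (Category.assoc _ _ _).trans ((congrArg (β.hom ≫ ·) hc₂).trans ?_)
      refine (Category.assoc _ _ _).symm.trans
        ((congrArg (· ≫ (projCell n d).hom) hβ₂).trans ?_)
      exact (h₂ d).trans (sndAt_congr hm.1 (A _) c d)

end

end SpanProduct

/-- Both sizes are covered at once: besides finite limits, the construction takes products only over
index sets of objects and apexes of indexing spans, all admissible for `κ`. -/
theorem hasIsoStrongProducts_spanDoubleCategory (κ : FamilySize) (S : Type u) [Category.{v} S]
    [HasFiniteLimits S] [HasFamilyProducts.{w} κ S] :
    HasIsoStrongProducts.{w} κ (spanDoubleCategory S) :=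
  ⟨SpanProduct.functor κ S, ⟨SpanProduct.doubleAdjunction κ S⟩,
    fun _ _ hm hn => SpanProduct.laxator_isGlobularIso hm hn, SpanProduct.unitor_isGlobularIso⟩

end

/-- The double category of spans in a finitely complete category has iso-strong finite products,
and if the category is complete then it has iso-strong products. -/
theorem mainTheorem5 (S : Type u) [Category.{v} S] [HasFiniteLimits S] :
    HasIsoStrongProducts.{w} FamilySize.finite (spanDoubleCategory S) ∧
      (HasLimitsOfSize.{w, w} S →
        HasIsoStrongProducts.{w} FamilySize.small (spanDoubleCategory S)) := by
  refine ⟨?_, fun _ => ?_⟩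
  -- Admissibility unfolds to `Finite I`, so finite limits provide these products.
  · have : HasFamilyProducts.{w} FamilySize.finite S := ⟨fun I (_ : Finite I) => inferInstance⟩
    exact hasIsoStrongProducts_spanDoubleCategory _ S
  · have : HasFamilyProducts.{w} FamilySize.small S := ⟨fun I _ => inferInstance⟩
    exact hasIsoStrongProducts_spanDoubleCategory _ S
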